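/- **Theorem.** For $n \geq 1$ let $[n]=\{1,\dots,n\}$. Let $\mathcal C$ be one of the following five categories, each with objects $[n]$, $n\ge 1$: $\mathrm{FA}$ (all maps); $\mathrm{OA}$ (order-preserving maps); $\mathrm{CA}$ (maps preserving the weak cyclic order, i.e. maps $f:[m]\to[n]$ such that, whenever some cyclic rotation of $(a,b,c,d)\in[m]^4$ is weakly increasing, so is some cyclic rotation of $(f(a),f(b),f(c),f(d))$); $\mathrm{BA}$ (maps preserving weak betweenness, i.e. $a\le b\le c$ or $c\le b\le a$); $\mathrm{SA}$ (maps preserving weak separation, i.e. the relation that some cyclic rotation of $(a,b,c,d)$ or of $(d,c,b,a)$ is weakly increasing). Let $G_n=\mathrm{Aut}_{\mathcal C}([n])$. Let $k$ be any commutative ring. A $\mathcal C$-module is a covariant functor from $\mathcal C$ to $k$-modules. The standard module $\Delta_n$ is the quotient of the representable functor $k\mathcal C([n],-)$ by the submodule spanned by all non-injective morphisms with source $[n]$. The mutation graph $\Gamma_{m,n}$ has as vertices the injective morphisms $[m]\to[n]$; two of them, $f$ and $g$, are joined by an edge if $f(i)\neq g(i)$ for exactly one $i\in[m]$ and there is a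 surjective morphism $h:[n]\to[n-1]$ with $h\circ f=h\circ g$. Then for all $m,n\ge 1$ $$\mathrm{Hom}_{k\mathcal C}(\Delta_m,\Delta_n)\;\cong\;\begin{cases} kG_n, & m=n,\\ k^{d}, & m=n+1,\\ 0, & \text{otherwise,}\end{cases}$$ where the isomorphism is one of $k$-algebras for $m=n$ and of $k$-modules for $m=n+1$, and where $d$ is the number of connected components of $\Gamma_{n,n+1}$. Explicitly, $d=1$ for $\mathrm{FA}$, $\mathrm{OA}$ and $\mathrm{CA}$ and all $n\ge 1$; for $\mathrm{BA}$, $d=2$ if $n\geq 2$ and $d=1$ if $n=1$; for $\mathrm{SA}$, $d=2$ if $n\geq 3$ and $d=1$ if $n\le 2$. -/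

import Mathlib

open CategoryTheory

universe u

/-- The five categories of finite substructures of the highly homogeneous structures: finite sets
(`FA`), linear orders (`OA`), cyclic orders (`CA`), linear betweenness relations (`BA`) and
separation relations (`SA`). -/
inductive CameronType : Type
  | FA | OA | CA | BA | SA

namespace CameronType

/-- `(a, b, c, d)` is in (weak) cyclic order: running once around the circle one meets
`a`, `b`, `c`, `d` in this order, where consecutive entries may coincide. Taking two consecutive
entries equal gives the ternary cyclic order. -/
def IsCyclic {n : ℕ} (a b c d : Fin n) : Prop :=
  (a ≤ b ∧ b ≤ c ∧ c ≤ d) ∨ (b ≤ c ∧ c ≤ d ∧ d ≤ a) ∨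
    (c ≤ d ∧ d ≤ a ∧ a ≤ b) ∨ (d ≤ a ∧ a ≤ b ∧ b ≤ c)

/-- `b` lies (weakly) between `a` and `c`. -/
def IsBetween {n : ℕ} (a b c : Fin n) : Prop :=
  (a ≤ b ∧ b ≤ c) ∨ (c ≤ b ∧ b ≤ a)

/-- The pair `{a, c}` (weakly) separates the pair `{b, d}` on the circle. -/
def IsSeparated {n : ℕ} (a b c d : Fin n) : Prop :=
  IsCyclic a b c d ∨ IsCyclic d c b a

/-- The maps of finite sets that preserve the structure of the given type. -/
def IsMorphism : CameronType → {m n : ℕ} → (Fin m → Fin n) → Prop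
  | FA, _, _, _ => True
  | OA, _, _, f => ∀ a b, a ≤ b → f a ≤ f b
  | CA, _, _, f => ∀ a b c d, IsCyclic a b c d → IsCyclic (f a) (f b) (f c) (f d)
  | BA, _, _, f => ∀ a b c, IsBetween a b c → IsBetween (f a) (f b) (f c)
  | SA, _, _, f => ∀ a b c d, IsSeparated a b c d → IsSeparated (f a) (f b) (f c) (f d)

theorem isMorphism_id (T : CameronType) (n : ℕ) : T.IsMorphism (id : Fin n → Fin n) := by
  cases T <;> simp [IsMorphism]

theorem isMorphism_comp (T : CameronType) {l m n : ℕ} {f : Fin l → Fin m} {g : Fin m → Fin n}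
    (hf : T.IsMorphism f) (hg : T.IsMorphism g) : T.IsMorphism (g ∘ f) := by
  cases T
  · trivial
  · exact fun a b h => hg _ _ (hf _ _ h)
  · exact fun a b c d h => hg _ _ _ _ (hf _ _ _ _ h)
  · exact fun a b c h => hg _ _ _ (hf _ _ _ h)
  · exact fun a b c d h => hg _ _ _ _ (hf _ _ _ _ h)

/-- The objects of the category of type `T`: one object `[n]` for every positive integer `n`. -/
structure Obj (T : CameronType) : Type where
  card : ℕ+

/-- The morphisms `[m] ⟶ [n]`: the structure-preserving maps of the underlying sets, where
`[n]` is realized on `Fin n`. -/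
@[ext]
structure Hom {T : CameronType} (x y : T.Obj) : Type where
  toFun : Fin x.card → Fin y.card
  isMorphism : T.IsMorphism toFun

instance (T : CameronType) : Category T.Obj where
  Hom x y := Hom x y
  id x := ⟨id, T.isMorphism_id _⟩
  comp f g := ⟨g.toFun ∘ f.toFun, T.isMorphism_comp f.isMorphism g.isMorphism⟩

/-- The object `[n]`. -/
def obj (T : CameronType) (n : ℕ+) : T.Obj := ⟨n⟩

variable {T : CameronType}

/-- The map of sets underlying a morphism. -/
def map {x y : T.Obj} (f : x ⟶ y) : Fin x.card → Fin y.card := Hom.toFun f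

/-- The group `G_n` of automorphisms of `[n]`. -/
abbrev G (T : CameronType) (n : ℕ+) : Type := Aut (T.obj n)

/-- `g` is a mutation of `f`: the two maps differ at exactly one point, and they become equal
after composition with some surjective morphism `h : [n] ⟶ [n - 1]`. -/
def IsMutation {x y : T.Obj} (f g : x ⟶ y) : Prop :=
  (∃! i, map f i ≠ map g i) ∧
    ∃ (z : T.Obj) (h : y ⟶ z), (z.card : ℕ) + 1 = y.card ∧ Function.Surjective (map h) ∧
      f ≫ h = g ≫ h

/-- The mutation graph `Γ_{m,n}` on the set of injective morphisms `[m] ⟶ [n]`. -/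
def mutationGraph (T : CameronType) (m n : ℕ+) :
    SimpleGraph {f : T.obj m ⟶ T.obj n // Function.Injective (map f)} where
  Adj f g := IsMutation f.1 g.1
  symm := ⟨by
    rintro f g ⟨⟨i, hi, hu⟩, z, h, hz, hs, he⟩
    exact ⟨⟨i, fun e => hi e.symm, fun j hj => hu j fun e => hj e.symm⟩, z, h, hz, hs, he.symm⟩⟩
  loopless := ⟨by
    rintro f ⟨⟨i, hi, -⟩, -⟩
    exact hi rfl⟩

/-- The number of connected components of the mutation graph `Γ_{m,n}`. -/
noncomputable def numComponents (T : CameronType) (m n : ℕ+) : ℕ :=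
  Nat.card (T.mutationGraph m n).ConnectedComponent

section Modules

variable (k : Type u) [CommRing k]

/-- The value at `y` of the submodule of the representable functor `P_x = k T(x, -)` spanned by all
non-injective morphisms with source `x`. -/
noncomputable def nonInjective (x y : T.Obj) : Submodule k ((x ⟶ y) →₀ k) :=
  Submodule.span k {v | ∃ f : x ⟶ y, ¬ Function.Injective (map f) ∧ v = Finsupp.single f 1}

/-- Postcomposition with `g`, as a map `P_x(y) → P_x(z)`. -/
noncomputable def postcomp (x : T.Obj) {y z : T.Obj} (g : y ⟶ z) :
    ((x ⟶ y) →₀ k) →ₗ[k] ((x ⟶ z) →₀ k) :=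
  Finsupp.lmapDomain k k fun f => f ≫ g

theorem nonInjective_le_comap (x : T.Obj) {y z : T.Obj} (g : y ⟶ z) :
    nonInjective k x y ≤ (nonInjective k x z).comap (postcomp k x g) := by
  refine Submodule.span_le.2 ?_
  rintro _ ⟨f, hf, rfl⟩
  refine Submodule.subset_span ⟨f ≫ g, fun h => hf ?_, by simp [postcomp]⟩
  exact Function.Injective.of_comp (f := map g) h

/-- The standard module `Δ_n`: the quotient of the representable functor `P_n = k T([n], -)` by
the submodule spanned by all non-injective morphisms with source `[n]`. -/
noncomputable def standardModule (T : CameronType) (n : ℕ+) : T.Obj ⥤ ModuleCat.{u} k where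
  obj y := ModuleCat.of k (((T.obj n ⟶ y) →₀ k) ⧸ nonInjective k (T.obj n) y)
  map g := ModuleCat.ofHom
    (Submodule.mapQ _ _ (postcomp k (T.obj n) g) (nonInjective_le_comap k (T.obj n) g))
  map_id y := by
    ext f
    simp [postcomp]
  map_comp g h := by
    ext f
    simp [postcomp]

end Modules

end CameronType

/-!
A homomorphism `φ : Δ_m ⟶ Δ_n` is determined by the image in `Δ_n([m])` of the generator `id` of
`Δ_m`. The module `Δ_n([m])` is free on the injective morphisms `[n] ⟶ [m]`, so `φ` is a function
`c` on those morphisms, and the functions that occur are the ones whose sums over the fibres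
`{f | h ∘ f = g}` vanish, for `h` non-injective and `g` injective (`exists_homCoeff_eq_iff`).

If `m < n` there is no injective morphism. If `m = n` there is no relation, because `h ∘ f` is never
injective, and the injective endomorphisms of `[n]` form the group `G_n` (`nonempty_end_algEquiv`).

For `m > n` the relevant fibres have at most two elements. Let `h` identify a point `a` missed by
`f` with a value `f i`, and no other points of the image of `f`. Then the only other element of the
fibre through `f` is the map `f'` obtained by moving the value at `i` to `a`. It is a morphism in
each of the five categories, for a uniform reason (`isMorphism_of_comp_injective`): between
identified `n`-point images a morphism becomes a bijective endomorphism of `[n]`, whose inverse is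
one of its powers. The relation reads `c f + c f' = 0`. If `m ≥ n + 2`, such moves bring two missed
points next to each other, where collapsing them shows `c f = 0` (`coeff_eq_zero_of_two_missed`). If
`m = n + 1`, these are all the relations, one for each edge of the mutation graph
(`fiberSum_eq_zero_iff`). Since a mutation multiplies the permutation of `[n + 1]` extending `f` by
a transposition, multiplication by its sign turns the solutions into the functions that are constant
on components (`nonempty_hom_succ_linearEquiv`).

To count components for sets, where any two points can be collapsed, one corrects the values of an
injection one at a time (`reachable_FA`). In the other four categories, write an injective morphism as an injective endomorphism `g` of `[n]` followed
by the increasing map that skips a point `a`. Collapsing neighbours changes `a` at will, and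
collapsing the two ends, which is allowed for cyclic orders and separation, rotates `g`
(`exists_rotation`). This leaves a single normal form, except that for betweenness and separation a
reflection may remain. In those two cases the orientation of the first two, respectively three,
points is unchanged by mutations: otherwise the collapsing map would identify three points.
-/

namespace CameronType

/-! ### Order-theoretic sources of morphisms -/

theorem isMorphism_of_monotone (T : CameronType) {m n : ℕ} {f : Fin m → Fin n}
    (hf : Monotone f) : T.IsMorphism f := by
  have hC : ∀ a b c d, IsCyclic a b c d → IsCyclic (f a) (f b) (f c) (f d) := fun a b c d =>
    Or.imp (fun h => ⟨hf h.1, hf h.2.1, hf h.2.2⟩) <|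
      Or.imp (fun h => ⟨hf h.1, hf h.2.1, hf h.2.2⟩) <|
        Or.imp (fun h => ⟨hf h.1, hf h.2.1, hf h.2.2⟩) fun h => ⟨hf h.1, hf h.2.1, hf h.2.2⟩
  cases T
  · trivial
  · exact fun a b h => hf h
  · exact hC
  · exact fun a b c => Or.imp (fun h => ⟨hf h.1, hf h.2⟩) fun h => ⟨hf h.1, hf h.2⟩
  · exact fun a b c d => Or.imp (hC _ _ _ _) (hC _ _ _ _)

theorem isMorphism_SA_of_CA {m n : ℕ} {f : Fin m → Fin n} (hf : CA.IsMorphism f) :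
    SA.IsMorphism f :=
  fun _ _ _ _ => Or.imp (hf _ _ _ _) (hf _ _ _ _)

theorem isMorphism_BA_of_antitone {m n : ℕ} {f : Fin m → Fin n} (hf : Antitone f) :
    BA.IsMorphism f :=
  fun _ _ _ h => h.symm.imp (fun h => ⟨hf h.2, hf h.1⟩) fun h => ⟨hf h.2, hf h.1⟩

theorem isMorphism_SA_of_antitone {m n : ℕ} {f : Fin m → Fin n} (hf : Antitone f) :
    SA.IsMorphism f := by
  have hC : ∀ a b c d, IsCyclic a b c d → IsCyclic (f d) (f c) (f b) (f a) := by
    rintro a b c d (h | h | h | h)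
    · exact .inl ⟨hf h.2.2, hf h.2.1, hf h.1⟩
    · exact .inr (.inr (.inr ⟨hf h.2.2, hf h.2.1, hf h.1⟩))
    · exact .inr (.inr (.inl ⟨hf h.2.2, hf h.2.1, hf h.1⟩))
    · exact .inr (.inl ⟨hf h.2.2, hf h.2.1, hf h.1⟩)
  exact fun a b c d h => h.symm.imp (hC _ _ _ _) (hC _ _ _ _)

/-- All the relations are defined from the order, so a strictly monotone map reflects them. -/
theorem isMorphism_comp_strictMono_iff (T : CameronType) {l m n : ℕ} {e : Fin m → Fin n}
    (he : StrictMono e) {f : Fin l → Fin m} : T.IsMorphism (e ∘ f) ↔ T.IsMorphism f := by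
  cases T <;> simp [IsMorphism, IsSeparated, IsCyclic, IsBetween, he.le_iff_le]

/-- The inverse of a bijective endomorphism is one of its powers, hence again a morphism. -/
theorem isMorphism_symm (T : CameronType) {n : ℕ} {σ : Equiv.Perm (Fin n)}
    (hσ : T.IsMorphism σ) : T.IsMorphism σ.symm := by
  have hpow : ∀ j : ℕ, T.IsMorphism ⇑(σ ^ j) := by
    intro j
    induction j with
    | zero => exact T.isMorphism_id n
    | succ j ih =>
      rw [pow_succ, Equiv.Perm.coe_mul]
      exact T.isMorphism_comp hσ ih
  have h : σ⁻¹ = σ ^ (orderOf σ - 1) := by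
    rw [inv_eq_iff_mul_eq_one, ← pow_succ', Nat.sub_add_cancel (orderOf_pos σ), pow_orderOf_eq_one]
  have := hpow (orderOf σ - 1)
  rwa [← h] at this

/-- A map of finite ordinals is a surjection followed by the increasing enumeration of its
image. -/
theorem exists_strictMono_comp_surjective {m n l : ℕ} (f : Fin m → Fin l)
    (hn : (Finset.univ.image f).card = n) :
    ∃ (e : Fin n → Fin l) (q : Fin m → Fin n),
      StrictMono e ∧ Function.Surjective q ∧ e ∘ q = f := by
  have hq : ∀ i, ∃ j, (Finset.univ.image f).orderEmbOfFin hn j = f i := by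
    intro i
    have : f i ∈ Set.range ((Finset.univ.image f).orderEmbOfFin hn) := by
      rw [Finset.range_orderEmbOfFin]
      simp
    exact this
  choose q hq using hq
  refine ⟨_, q, ((Finset.univ.image f).orderEmbOfFin hn).strictMono, fun j => ?_, funext hq⟩
  obtain ⟨i, -, hi⟩ := Finset.mem_image.1 ((Finset.univ.image f).orderEmbOfFin_mem hn j)
  exact ⟨i, ((Finset.univ.image f).orderEmbOfFin hn).injective ((hq i).trans hi)⟩

/-- A lift `f` of an injective morphism along a morphism `h` is a morphism: `h` restricts to a
bijective morphism between the images of `f` and of `h ∘ f`, which is invertible once both images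
are identified with `[n]`. -/
theorem isMorphism_of_comp_injective (T : CameronType) {l m n : ℕ} {h : Fin m → Fin l}
    {f : Fin n → Fin m} (hh : T.IsMorphism h) (hhf : T.IsMorphism (h ∘ f))
    (hinj : Function.Injective (h ∘ f)) : T.IsMorphism f := by
  have hf : Function.Injective f := hinj.of_comp
  obtain ⟨e, v, he, hv, rfl⟩ := exists_strictMono_comp_surjective f
    (by rw [Finset.card_image_of_injective _ hf, Finset.card_fin])
  obtain ⟨e', w, he', hw, hew⟩ := exists_strictMono_comp_surjective (h ∘ e ∘ v)
    (by rw [Finset.card_image_of_injective _ hinj, Finset.card_fin])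
  let V : Equiv.Perm (Fin n) := Equiv.ofBijective v ⟨hf.of_comp, hv⟩
  let W : Equiv.Perm (Fin n) := Equiv.ofBijective w (Finite.surjective_iff_bijective.1 hw)
  have hW : T.IsMorphism W :=
    (T.isMorphism_comp_strictMono_iff he').1 (by rw [← hew] at hhf; exact hhf)
  have hU : T.IsMorphism (W * V⁻¹ : Equiv.Perm (Fin n)) := by
    rw [← T.isMorphism_comp_strictMono_iff he']
    have : e' ∘ ⇑(W * V⁻¹) = h ∘ e := by
      funext i
      have := congrFun hew (V⁻¹ i)
      have hi : v (V.symm i) = i := V.apply_symm_apply i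
      simpa [hi, W] using this
    rw [this]
    exact T.isMorphism_comp (T.isMorphism_of_monotone he.monotone) hh
  have hV : T.IsMorphism ⇑((W * V⁻¹)⁻¹ * W) := by
    rw [Equiv.Perm.coe_mul]
    exact T.isMorphism_comp hW (T.isMorphism_symm hU)
  rw [mul_inv_rev, inv_inv, inv_mul_cancel_right] at hV
  exact T.isMorphism_comp hV (T.isMorphism_of_monotone he.monotone)

/-! ### Homomorphisms of standard modules as coefficient functions -/

section Coefficients

variable {T : CameronType}

theorem map_injective {x y : T.Obj} : Function.Injective (map : (x ⟶ y) → _) :=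
  fun _ _ h => Hom.ext h

theorem map_comp {x y z : T.Obj} (f : x ⟶ y) (g : y ⟶ z) : map (f ≫ g) = map g ∘ map f := rfl

instance (x y : T.Obj) : Finite (x ⟶ y) := Finite.of_injective map map_injective

/-- The injective morphisms from `x` to `y`. -/
abbrev Emb (x y : T.Obj) : Type := {f : x ⟶ y // Function.Injective (map f)}

noncomputable instance (x y : T.Obj) : Fintype (Emb x y) := Fintype.ofFinite _

variable (k : Type u) [CommRing k]

theorem mem_nonInjective {x y : T.Obj} {w : (x ⟶ y) →₀ k} :
    w ∈ nonInjective k x y ↔ ∀ f : Emb x y, w f.1 = 0 := by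
  have h : nonInjective k x y = Finsupp.supported k k {f | ¬ Function.Injective (map f)} := by
    rw [Finsupp.supported_eq_span_single, nonInjective]
    congr 1
    ext v
    simp [eq_comm]
  rw [h, Finsupp.mem_supported']
  simp

/-- The coefficients at the injective morphisms `x ⟶ y` of an element of `Δ_x(y)`. -/
noncomputable def coeff (x y : T.Obj) :
    (((x ⟶ y) →₀ k) ⧸ nonInjective k x y) →ₗ[k] (Emb x y → k) :=
  (nonInjective k x y).liftQ (LinearMap.pi fun f => Finsupp.lapply f.1) fun w hw => by
    ext f
    exact (mem_nonInjective k).1 hw f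

theorem coeff_mk {x y : T.Obj} (w : (x ⟶ y) →₀ k) (f : Emb x y) :
    coeff k x y (Submodule.Quotient.mk w) f = w f.1 := rfl

theorem coeff_injective (x y : T.Obj) : Function.Injective (coeff k x y) := by
  rw [injective_iff_map_eq_zero]
  intro v hv
  obtain ⟨w, rfl⟩ := Submodule.Quotient.mk_surjective _ v
  exact (Submodule.Quotient.mk_eq_zero _).2 <| (mem_nonInjective k).2 fun f => congrFun hv f

theorem coeff_surjective (x y : T.Obj) : Function.Surjective (coeff k x y) := by
  classical
  intro c
  refine ⟨Submodule.Quotient.mk (Finsupp.equivFunOnFinite.symm fun f =>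
    if hf : Function.Injective (map f) then c ⟨f, hf⟩ else 0), ?_⟩
  ext f
  simp [coeff_mk, f.2]

open Classical in
/-- The sum of the coefficients `c f` over the fibre `{f | h ∘ f = g}` of postcomposition
with `h`. -/
noncomputable def fiberSum {k : Type u} [CommRing k] {x y z : T.Obj} (c : Emb x y → k) (h : y ⟶ z)
    (g : x ⟶ z) : k :=
  ∑ f : Emb x y, if f.1 ≫ h = g then c f else 0

theorem coeff_postcomp {x y z : T.Obj} (h : y ⟶ z) (v : ((x ⟶ y) →₀ k) ⧸ nonInjective k x y)
    (g : Emb x z) :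
    coeff k x z (Submodule.mapQ _ _ (postcomp k x h) (nonInjective_le_comap k x h) v) g =
      fiberSum (coeff k x y v) h g.1 := by
  classical
  obtain ⟨w, rfl⟩ := Submodule.Quotient.mk_surjective _ v
  change Finsupp.mapDomain (fun f => f ≫ h) w g.1 = _
  induction w using Finsupp.induction_linear with
  | zero => simp [fiberSum]
  | add w w' hw hw' =>
    rw [Finsupp.mapDomain_add, Finsupp.add_apply, hw, hw']
    simp only [fiberSum, ← Finset.sum_add_distrib, coeff_mk]
    refine Finset.sum_congr rfl fun f _ => ?_
    split_ifs <;> simp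
  | single f a =>
    simp only [fiberSum, coeff_mk, Finsupp.mapDomain_single, Finsupp.single_apply]
    by_cases hfg : f ≫ h = g.1
    · have hf : Function.Injective (map f) :=
        Function.Injective.of_comp (f := map h) (by rw [← map_comp, hfg]; exact g.2)
      rw [if_pos hfg, Finset.sum_eq_single ⟨f, hf⟩]
      · simp [hfg]
      · intro f' _ hf'
        have : f ≠ f'.1 := fun e => hf' (Subtype.ext e.symm)
        simp [this]
      · simp
    · rw [if_neg hfg, Finset.sum_eq_zero]
      intro f' _
      split_ifs with h1 h2
      · subst h2
        exact absurd h1 hfg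
      · rfl
      · rfl

variable {k} (m n : ℕ+)

/-- A homomorphism `φ : Δ_m ⟶ Δ_n` is recorded by the coefficients of the image of the
generator `id` of `Δ_m`. -/
noncomputable def homCoeff :
    (T.standardModule k m ⟶ T.standardModule k n) →ₗ[k] (Emb (T.obj n) (T.obj m) → k) where
  toFun φ := coeff k _ _ ((φ.app (T.obj m)).hom (Submodule.Quotient.mk (Finsupp.single (𝟙 _) 1)))
  map_add' _ _ := map_add (coeff k _ _) _ _
  map_smul' r _ := map_smul (coeff k _ _) r _

variable {m n}

theorem app_mk_single (φ : T.standardModule k m ⟶ T.standardModule k n) {y : T.Obj}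
    (h : T.obj m ⟶ y) :
    (φ.app y).hom (Submodule.Quotient.mk (Finsupp.single h 1)) =
      ((T.standardModule k n).map h).hom
        ((φ.app (T.obj m)).hom (Submodule.Quotient.mk (Finsupp.single (𝟙 _) 1))) := by
  have := LinearMap.congr_fun (congrArg ModuleCat.Hom.hom (φ.naturality h))
    (Submodule.Quotient.mk (Finsupp.single (𝟙 _) 1))
  refine Eq.trans ?_ this
  change _ = (φ.app y).hom (Submodule.Quotient.mk (postcomp k _ h (Finsupp.single (𝟙 _) 1)))
  simp [postcomp]

theorem homCoeff_injective : Function.Injective (homCoeff (T := T) (k := k) m n) := by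
  rw [injective_iff_map_eq_zero]
  intro φ hφ
  have h0 : (φ.app (T.obj m)).hom (Submodule.Quotient.mk (Finsupp.single (𝟙 _) 1)) = 0 :=
    coeff_injective k _ _ (hφ.trans (map_zero _).symm)
  ext y : 2
  refine ModuleCat.hom_ext (Submodule.linearMap_qext _ (Finsupp.lhom_ext' fun h =>
    LinearMap.ext_ring ?_))
  change (φ.app y).hom (Submodule.Quotient.mk (Finsupp.single h 1)) = 0
  rw [app_mk_single, h0, map_zero]

/-- `Δ_m` is presented by its generator `id` and the relations saying that the non-injective
morphisms `h` with source `[m]` act on it by zero. On coefficients these relations are the vanishing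
of the fibre sums. -/
theorem exists_homCoeff_eq_iff (c : Emb (T.obj n) (T.obj m) → k) :
    (∃ φ : T.standardModule k m ⟶ T.standardModule k n, homCoeff m n φ = c) ↔
      ∀ (z : T.Obj) (h : T.obj m ⟶ z), ¬ Function.Injective (map h) →
        ∀ g : Emb (T.obj n) z, fiberSum c h g.1 = 0 := by
  constructor
  · rintro ⟨φ, rfl⟩ z h hh g
    have h1 := app_mk_single φ h
    have h2 : (Submodule.Quotient.mk (Finsupp.single h (1 : k)) : _ ⧸ nonInjective k (T.obj m) z)
        = 0 := (Submodule.Quotient.mk_eq_zero _).2 (Submodule.subset_span ⟨h, hh, rfl⟩)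
    have h3 := congrFun (congrArg (coeff k (T.obj n) z) h1) g
    refine (coeff_postcomp k h _ g).symm.trans (h3.symm.trans ?_)
    have h4 := congrArg (fun v => coeff k (T.obj n) z ((φ.app z).hom v) g) h2
    refine h4.trans ?_
    change coeff k (T.obj n) z ((φ.app z).hom 0) g = 0
    rw [map_zero]
    rfl
  · intro hc
    obtain ⟨v, rfl⟩ := coeff_surjective k _ _ c
    let D := T.standardModule k n
    let ev : ∀ y : T.Obj, ((T.obj m ⟶ y) →₀ k) →ₗ[k] D.obj y := fun y =>
      Finsupp.lsum k fun h => LinearMap.toSpanSingleton k (D.obj y) ((D.map h).hom v)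
    have ev_single : ∀ (y : T.Obj) (h : T.obj m ⟶ y),
        ev y (Finsupp.single h 1) = (D.map h).hom v := by
      intro y h
      simp [ev]
    have hev : ∀ y, nonInjective k (T.obj m) y ≤ LinearMap.ker (ev y) := by
      intro y
      refine Submodule.span_le.2 ?_
      rintro _ ⟨h, hh, rfl⟩
      refine (ev_single y h).trans (coeff_injective k _ _ (funext fun g => ?_))
      exact (coeff_postcomp k h v g).trans ((hc y h hh g).trans
        (congrFun (map_zero (coeff k (T.obj n) y)) g).symm)
    let φ : T.standardModule k m ⟶ D :=
      { app y := ModuleCat.ofHom ((nonInjective k (T.obj m) y).liftQ (ev y) (hev y))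
        naturality y z g := by
          refine ModuleCat.hom_ext (Submodule.linearMap_qext _ (Finsupp.lhom_ext' fun h =>
            LinearMap.ext_ring ?_))
          change ev z (postcomp k _ g (Finsupp.single h 1)) =
            (D.map g).hom (ev y (Finsupp.single h 1))
          rw [postcomp, Finsupp.lmapDomain_apply, Finsupp.mapDomain_single, ev_single, ev_single,
            D.map_comp]
          rfl }
    refine ⟨φ, congrArg (coeff k _ _) ?_⟩
    change ev _ (Finsupp.single (𝟙 _) 1) = v
    rw [ev_single, D.map_id]
    rfl

end Coefficients

/-! ### Fibres of collapsing morphisms -/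

section Fibers

variable {T : CameronType} {k : Type u} [CommRing k] {x y z : T.Obj}

/-- If `h` is one-to-one over the image of `f`, the fibre of `h ∘ f` is `{f}`. -/
theorem fiberSum_eq_single (c : Emb x y → k) (h : y ⟶ z) (f : Emb x y)
    (hfib : ∀ i p, map h p = map h (map f.1 i) → p = map f.1 i) :
    fiberSum c h (f.1 ≫ h) = c f := by
  classical
  rw [fiberSum, Finset.sum_eq_single f]
  · simp
  · intro f' _ hne
    refine if_neg fun e => hne (Subtype.ext (map_injective (funext fun i => ?_)))
    exact hfib i _ (congrFun (congrArg map e) i)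
  · simp

/-- If `h` identifies a point `a` missed by `f` with the value `f i₀`, and is otherwise one-to-one
over the image of `f`, then the fibre of `h ∘ f` consists of `f` and of the morphism that takes the
value `a` at `i₀` instead. -/
theorem exists_fiberSum_eq_add (h : y ⟶ z) (f : Emb x y) (i₀ : Fin x.card) (a : Fin y.card)
    (ha : ∀ i, map f.1 i ≠ a) (hinj : Function.Injective (map (f.1 ≫ h)))
    (hia : map h a = map h (map f.1 i₀))
    (hfib : ∀ i p, map h p = map h (map f.1 i) → p = map f.1 i ∨ (i = i₀ ∧ p = a)) :
    ∃ f' : Emb x y, map f'.1 = Function.update (map f.1) i₀ a ∧ f.1 ≫ h = f'.1 ≫ h ∧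
      ∀ c : Emb x y → k, fiberSum c h (f.1 ≫ h) = c f + c f' := by
  classical
  have hcomp : map h ∘ Function.update (map f.1) i₀ a = map h ∘ map f.1 := by
    funext i
    rcases eq_or_ne i i₀ with rfl | hi
    · simp [hia]
    · simp [hi]
  have hmor : T.IsMorphism (map h ∘ Function.update (map f.1) i₀ a) := by
    rw [hcomp]
    exact (f.1 ≫ h).isMorphism
  have hinj' : Function.Injective (map h ∘ Function.update (map f.1) i₀ a) := by
    rw [hcomp]
    exact hinj
  let f' : Emb x y := ⟨⟨Function.update (map f.1) i₀ a,
    T.isMorphism_of_comp_injective h.isMorphism hmor hinj'⟩, hinj'.of_comp⟩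
  have hf' : map f'.1 = Function.update (map f.1) i₀ a := rfl
  have hff' : f.1 ≫ h = f'.1 ≫ h := map_injective hcomp.symm
  have hne : f ≠ f' := fun e => ha i₀ (by rw [e, hf', Function.update_self])
  refine ⟨f', hf', hff', fun c => ?_⟩
  rw [fiberSum, Finset.sum_eq_add f f' hne]
  · simp [hff']
  · rintro f'' - ⟨h1, h2⟩
    refine if_neg fun e => ?_
    have hi : ∀ i, map f''.1 i = map f.1 i ∨ (i = i₀ ∧ map f''.1 i = a) := fun i =>
      hfib i _ (congrFun (congrArg map e) i)
    rcases hi i₀ with h0 | ⟨-, h0⟩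
    · refine h1 (Subtype.ext (map_injective (funext fun i => ?_)))
      rcases hi i with h | ⟨rfl, -⟩
      exacts [h, h0]
    · refine h2 (Subtype.ext (map_injective (funext fun i => ?_)))
      rw [hf']
      rcases eq_or_ne i i₀ with rfl | hne
      · simpa using h0
      · simpa [hne] using (hi i).resolve_right fun h => hne h.1
  · simp
  · simp

/-- Collapsing the adjacent points `a` and `a + 1`. -/
theorem exists_collapse (a b : Fin y.card) (hab : (b : ℕ) = a + 1) :
    ∃ (z : T.Obj) (h : y ⟶ z), ∀ p q : Fin y.card,
        map h p = map h q ↔ p = q ∨ (p = a ∧ q = b) ∨ (p = b ∧ q = a) := by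
  let z : T.Obj := ⟨⟨(y.card : ℕ) - 1, by omega⟩⟩
  let h : Fin y.card → Fin z.card := fun p =>
    ⟨if p ≤ a then p else p - 1, by
      change _ < (y.card : ℕ) - 1
      split_ifs <;> grind⟩
  have hh : Monotone h := by
    intro p q hpq
    simp only [h, Fin.mk_le_mk]
    grind
  refine ⟨z, ⟨h, T.isMorphism_of_monotone hh⟩, fun p q => ?_⟩
  change h p = h q ↔ _
  simp only [h, Fin.mk.injEq]
  grind

/-- The relations force a coefficient to vanish as soon as two points `a < b` are missed: if
`a + 1` is missed as well, collapse `a` and `a + 1`; otherwise the collapse relates `f` to the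
morphism that misses `a + 1` and `b`, and the gap has become smaller. -/
theorem coeff_eq_zero_of_two_missed {c : Emb x y → k}
    (hc : ∀ (z : T.Obj) (h : y ⟶ z), ¬ Function.Injective (map h) →
      ∀ g : Emb x z, fiberSum c h g.1 = 0) (d : ℕ) :
    ∀ (f : Emb x y) (a b : Fin y.card), (b : ℕ) = a + 1 + d →
      (∀ i, map f.1 i ≠ a) → (∀ i, map f.1 i ≠ b) → c f = 0 := by
  induction d with
  | zero =>
    intro f a b hab ha hb
    obtain ⟨z, h, hh⟩ := exists_collapse a b hab
    have hninj : ¬ Function.Injective (map h) := fun hi => by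
      have := hi ((hh a b).2 (.inr (.inl ⟨rfl, rfl⟩)))
      simp [this] at hab
    have hfib : ∀ i p, map h p = map h (map f.1 i) → p = map f.1 i := fun i p hp =>
      ((hh _ _).1 hp).resolve_right (by rintro (⟨-, e⟩ | ⟨-, e⟩); exacts [hb i e, ha i e])
    have hinj : Function.Injective (map (f.1 ≫ h)) := fun i j hij => f.2 (hfib j _ hij)
    rw [← fiberSum_eq_single c h f hfib]
    exact hc z h hninj ⟨_, hinj⟩
  | succ d ih =>
    intro f a b hab ha hb
    obtain ⟨a', ha'⟩ : ∃ a' : Fin y.card, (a' : ℕ) = a + 1 := ⟨⟨a + 1, by omega⟩, rfl⟩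
    by_cases hm : ∀ i, map f.1 i ≠ a'
    · exact ih f a' b (by omega) hm hb
    push Not at hm
    obtain ⟨i₀, hi₀⟩ := hm
    obtain ⟨z, h, hh⟩ := exists_collapse a a' ha'
    have hia : map h a = map h (map f.1 i₀) := by
      rw [hi₀]
      exact (hh _ _).2 (.inr (.inl ⟨rfl, rfl⟩))
    have hninj : ¬ Function.Injective (map h) := fun hi => ha i₀ (hi hia).symm
    have hfib : ∀ i p, map h p = map h (map f.1 i) → p = map f.1 i ∨ (i = i₀ ∧ p = a) := by
      intro i p hp
      rcases (hh _ _).1 hp with e | ⟨e, e'⟩ | ⟨-, e⟩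
      · exact .inl e
      · exact .inr ⟨f.2 (e'.trans hi₀.symm), e⟩
      · exact absurd e (ha i)
    have hinj : Function.Injective (map (f.1 ≫ h)) := fun i j hij =>
      f.2 ((hfib j _ hij).resolve_right fun e => ha i e.2)
    obtain ⟨f', hf', -, hsum⟩ := exists_fiberSum_eq_add (k := k) h f i₀ a ha hinj hia hfib
    have hf'b : ∀ i, map f'.1 i ≠ b := by
      intro i
      rw [hf']
      rcases eq_or_ne i i₀ with rfl | hi
      · rw [Function.update_self]
        intro e
        rw [e] at hab
        omega
      · rw [Function.update_of_ne hi]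
        exact hb i
    have hf'a : ∀ i, map f'.1 i ≠ a' := by
      intro i
      rw [hf']
      rcases eq_or_ne i i₀ with rfl | hi
      · rw [Function.update_self]
        intro e
        rw [e] at ha'
        omega
      · rw [Function.update_of_ne hi, ← hi₀]
        exact fun e => hi (f.2 e)
    have h1 := (hsum c).symm.trans (hc z h hninj ⟨_, hinj⟩)
    rwa [ih f' a' b (by omega) hf'a hf'b, add_zero] at h1

/-- An injection of `[n]` into `[n + 1]` misses exactly one point. -/
theorem exists_missed (hy : (y.card : ℕ) = x.card + 1) (f : Emb x y) :
    ∃ a, (∀ i, map f.1 i ≠ a) ∧ ∀ p, p = a ∨ ∃ i, map f.1 i = p := by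
  classical
  have h1 : (Finset.univ.image (map f.1))ᶜ.card = 1 := by
    rw [Finset.card_compl, Finset.card_image_of_injective _ f.2, Finset.card_fin, Fintype.card_fin]
    omega
  obtain ⟨a, ha⟩ := Finset.card_eq_one.1 h1
  have h2 : ∀ p, (∀ i, map f.1 i ≠ p) ↔ p = a := by
    intro p
    rw [← Finset.mem_singleton, ← ha]
    simp
  refine ⟨a, (h2 a).2 rfl, fun p => ?_⟩
  by_contra! hp
  exact hp.1 ((h2 p).1 hp.2)

theorem eq_or_mem_of_missed (hy : (y.card : ℕ) = x.card + 1) (f : Emb x y) {a : Fin y.card}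
    (ha : ∀ i, map f.1 i ≠ a) (p : Fin y.card) : p = a ∨ ∃ i, map f.1 i = p := by
  obtain ⟨a', -, hr⟩ := exists_missed hy f
  obtain rfl : a = a' := (hr a).resolve_right fun ⟨i, hi⟩ => ha i hi
  exact hr p

/-- A surjection of `[n + 1]` onto `[n]` that identifies the point missed by `f` with a value
of `f` is one-to-one on the image of `f`. -/
theorem injective_comp_of_collapse (hy : (y.card : ℕ) = x.card + 1) (f : Emb x y) (h : y ⟶ z)
    (hz : (z.card : ℕ) + 1 = y.card) (hs : Function.Surjective (map h)) {i₀ : Fin x.card}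
    {a : Fin y.card} (ha : ∀ i, map f.1 i ≠ a) (hia : map h a = map h (map f.1 i₀)) :
    Function.Injective (map (f.1 ≫ h)) := by
  have hsurj : Function.Surjective (map (f.1 ≫ h)) := by
    intro q
    obtain ⟨p, rfl⟩ := hs q
    rcases eq_or_mem_of_missed hy f ha p with rfl | ⟨i, rfl⟩
    exacts [⟨i₀, hia.symm⟩, ⟨i, rfl⟩]
  have hxz : x.card = z.card := PNat.eq (by omega)
  refine ((Fintype.bijective_iff_surjective_and_card _).2 ⟨hsurj, ?_⟩).1
  rw [Fintype.card_fin, Fintype.card_fin, hxz]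

theorem IsMutation.exists_update {f f' : Emb x y} (h : IsMutation f.1 f'.1) :
    ∃ i₀ a, (∀ i, map f.1 i ≠ a) ∧ map f'.1 = Function.update (map f.1) i₀ a := by
  obtain ⟨⟨i₀, hi₀, hu⟩, -⟩ := h
  have hne : ∀ j, j ≠ i₀ → map f'.1 j = map f.1 j := fun j hj => by
    by_contra e
    exact hj (hu j fun e' => e e'.symm)
  refine ⟨i₀, map f'.1 i₀, fun i e => ?_, funext fun i => ?_⟩
  · rcases eq_or_ne i i₀ with rfl | hi
    · exact hi₀ e
    · exact hi (f'.2 ((hne i hi).trans e))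
  · rcases eq_or_ne i i₀ with rfl | hi
    · simp
    · simp [hi, hne i hi]

theorem existsUnique_ne_of_update {f f' : Emb x y} {i₀ : Fin x.card} {a : Fin y.card}
    (ha : ∀ i, map f.1 i ≠ a) (h : map f'.1 = Function.update (map f.1) i₀ a) :
    ∃! i, map f.1 i ≠ map f'.1 i := by
  refine ⟨i₀, by simpa [h] using ha i₀, fun j hj => ?_⟩
  by_contra hne
  exact hj (by simp [h, hne])

/-- For injections of `[n]` into `[n + 1]` the defining relations of `Hom(Δ_{n+1}, Δ_n)` say that
the coefficients of two neighbours in the mutation graph cancel. -/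
theorem fiberSum_eq_zero_iff (hy : (y.card : ℕ) = x.card + 1) (c : Emb x y → k) :
    (∀ (z : T.Obj) (h : y ⟶ z), ¬ Function.Injective (map h) →
      ∀ g : Emb x z, fiberSum c h g.1 = 0) ↔
      ∀ f f' : Emb x y, IsMutation f.1 f'.1 → c f + c f' = 0 := by
  classical
  constructor
  · intro hc f f' hff'
    obtain ⟨i₀, a, ha, hf'⟩ := hff'.exists_update
    obtain ⟨-, z, h, hz, hs, hcomp⟩ := hff'
    have hia : map h a = map h (map f.1 i₀) := by
      have := congrFun (congrArg map hcomp) i₀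
      rw [map_comp, map_comp, hf'] at this
      simpa using this.symm
    have hninj : ¬ Function.Injective (map h) := fun hi => ha i₀ (hi hia).symm
    have hrange := eq_or_mem_of_missed hy f ha
    have hinj := injective_comp_of_collapse hy f h hz hs ha hia
    have hfib : ∀ i p, map h p = map h (map f.1 i) → p = map f.1 i ∨ (i = i₀ ∧ p = a) := by
      intro i p hp
      rcases hrange p with rfl | ⟨j, rfl⟩
      · exact .inr ⟨hinj (hp.symm.trans hia), rfl⟩
      · exact .inl (congrArg _ (hinj hp))
    obtain ⟨f'', hf'', -, hsum⟩ := exists_fiberSum_eq_add (k := k) h f i₀ a ha hinj hia hfib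
    obtain rfl : f' = f'' := Subtype.ext (map_injective (hf'.trans hf''.symm))
    exact (hsum c).symm.trans (hc z h hninj ⟨_, hinj⟩)
  · intro hc z h hninj g
    by_cases hex : ∃ f : Emb x y, f.1 ≫ h = g.1
    swap
    · exact Finset.sum_eq_zero fun f _ => if_neg fun e => hex ⟨f, e⟩
    obtain ⟨f, hf⟩ := hex
    have hinj : Function.Injective (map (f.1 ≫ h)) := by
      rw [hf]
      exact g.2
    obtain ⟨a, ha, hrange⟩ := exists_missed hy f
    obtain ⟨i₀, hia⟩ : ∃ i₀, map h a = map h (map f.1 i₀) := by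
      by_contra! hne
      refine hninj fun p q hpq => ?_
      rcases hrange p with rfl | ⟨i, rfl⟩ <;> rcases hrange q with rfl | ⟨j, rfl⟩
      · rfl
      · exact absurd hpq (hne j)
      · exact absurd hpq.symm (hne i)
      · exact congrArg _ (hinj hpq)
    have hfib : ∀ i p, map h p = map h (map f.1 i) → p = map f.1 i ∨ (i = i₀ ∧ p = a) := by
      intro i p hp
      rcases hrange p with rfl | ⟨j, rfl⟩
      · exact .inr ⟨hinj (hp.symm.trans hia), rfl⟩
      · exact .inl (congrArg _ (hinj hp))
    obtain ⟨f', hf', hcomp, hsum⟩ := exists_fiberSum_eq_add (k := k) h f i₀ a ha hinj hia hfib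
    rw [← hf, hsum]
    refine hc f f' ⟨existsUnique_ne_of_update ha hf', ?_⟩
    -- The image of `h` has as many points as `x`, so `h` factors through a surjection onto `x`.
    have himage : (Finset.univ.image (map h)).card = x.card := by
      have : Finset.univ.image (map h) = Finset.univ.image (map (f.1 ≫ h)) := by
        ext q
        simp only [Finset.mem_image, Finset.mem_univ, true_and]
        constructor
        · rintro ⟨p, rfl⟩
          rcases hrange p with rfl | ⟨i, rfl⟩
          exacts [⟨i₀, hia.symm⟩, ⟨i, rfl⟩]
        · rintro ⟨i, rfl⟩
          exact ⟨_, rfl⟩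
      rw [this, Finset.card_image_of_injective _ hinj, Finset.card_fin]
    obtain ⟨e, q, he, hq, heq⟩ := exists_strictMono_comp_surjective (map h) himage
    have hqm : T.IsMorphism q := (T.isMorphism_comp_strictMono_iff he).1 (heq ▸ h.isMorphism)
    refine ⟨x, ⟨q, hqm⟩, hy.symm, hq, map_injective (funext fun i => he.injective ?_)⟩
    have h1 := congrFun (congrArg map hcomp) i
    have h2 : ∀ p, e (q p) = map h p := congrFun heq
    exact (h2 _).trans (h1.trans (h2 _).symm)

/-- A sign for injections of `[n]` into `[n + 1]` that changes along every edge of the mutation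
graph, namely the sign of the unique extension to a permutation of `[n + 1]`. -/
theorem exists_sign (hy : (y.card : ℕ) = x.card + 1) :
    ∃ ε : Emb x y → ℤˣ, ∀ f f' : Emb x y, IsMutation f.1 f'.1 → ε f' = - ε f := by
  classical
  rcases isEmpty_or_nonempty (Emb x y) with hE | ⟨⟨j⟩⟩
  · exact ⟨fun _ => 1, fun f => hE.elim f⟩
  have hσ : ∀ f : Emb x y, ∃ σ : Equiv.Perm (Fin y.card), ∀ i, σ (map j.1 i) = map f.1 i := by
    intro f
    refine ⟨((Equiv.ofInjective _ j.2).symm.trans (Equiv.ofInjective _ f.2)).extendSubtype,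
      fun i => ?_⟩
    rw [Equiv.extendSubtype_apply_of_mem _ _ ⟨i, rfl⟩]
    simp [Equiv.ofInjective_symm_apply]
  choose σ hσ using hσ
  refine ⟨fun f => Equiv.Perm.sign (σ f), fun f f' hff' => ?_⟩
  obtain ⟨i₀, a, ha, hf'⟩ := hff'.exists_update
  have h : σ f' = Equiv.swap (map f.1 i₀) a * σ f := by
    obtain ⟨b, -, hr⟩ := exists_missed hy j
    have hj : ∀ i, σ f' (map j.1 i) = (Equiv.swap (map f.1 i₀) a * σ f) (map j.1 i) := by
      intro i
      rw [Equiv.Perm.mul_apply, hσ, hσ, hf']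
      rcases eq_or_ne i i₀ with rfl | hi
      · simp
      · rw [Function.update_of_ne hi, Equiv.swap_apply_of_ne_of_ne (fun e => hi (f.2 e)) (ha i)]
    -- Two permutations that agree off one point are equal.
    have h1 : ((Equiv.swap (map f.1 i₀) a * σ f)⁻¹ * σ f') = 1 := by
      have hfix : ∀ i, ((Equiv.swap (map f.1 i₀) a * σ f)⁻¹ * σ f') (map j.1 i) = map j.1 i := by
        intro i
        rw [Equiv.Perm.mul_apply, hj]
        exact Equiv.symm_apply_apply _ _
      ext p : 1
      rcases hr p with rfl | ⟨i, rfl⟩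
      · by_contra hne
        rcases hr (((Equiv.swap (map f.1 i₀) a * σ f)⁻¹ * σ f') p) with e | ⟨i, hi⟩
        · exact hne e
        · have := Equiv.injective _ ((hfix i).trans hi)
          exact hne (by rw [← hi]; exact this)
      · exact hfix i
    exact (inv_mul_eq_one.1 h1).symm
  simp only [h, Equiv.Perm.sign_mul, Equiv.Perm.sign_swap (ha i₀), neg_mul, one_mul]

end Fibers

/-! ### The spaces of homomorphisms -/

section HomSpaces

variable {T : CameronType} {k : Type u} [CommRing k]

theorem hom_eq_zero {m n : ℕ+} (h : m ≠ n) (h' : m ≠ n + 1)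
    (φ : T.standardModule k m ⟶ T.standardModule k n) : φ = 0 := by
  refine homCoeff_injective ((funext fun f => ?_).trans (map_zero _).symm)
  have hle : (n : ℕ) ≤ m := by
    have := Fintype.card_le_of_injective _ f.2
    rwa [Fintype.card_fin, Fintype.card_fin] at this
  have hmn : (n : ℕ) + 2 ≤ m := by
    have h1 : (m : ℕ) ≠ n := fun e => h (PNat.eq e)
    have h2 : (m : ℕ) ≠ n + 1 := fun e => h' (PNat.eq e)
    omega
  classical
  have hcard : 1 < (Finset.univ.image (map f.1))ᶜ.card := by
    rw [Finset.card_compl, Finset.card_image_of_injective _ f.2, Finset.card_fin, Fintype.card_fin]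
    change 1 < (m : ℕ) - n
    omega
  obtain ⟨a, b, ha, hb, hab⟩ := Finset.one_lt_card_iff.1 hcard
  have hr := (exists_homCoeff_eq_iff (homCoeff m n φ)).1 ⟨φ, rfl⟩
  have hmem : ∀ p, p ∈ (Finset.univ.image (map f.1))ᶜ → ∀ i, map f.1 i ≠ p := by simp
  rcases lt_or_gt_of_ne (Fin.val_ne_of_ne hab) with hlt | hlt
  · exact coeff_eq_zero_of_two_missed hr (b - a - 1) f a b (by omega) (hmem a ha) (hmem b hb)
  · exact coeff_eq_zero_of_two_missed hr (a - b - 1) f b a (by omega) (hmem b hb) (hmem a ha)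

/-- After multiplication with the alternating sign, the coefficient functions of homomorphisms
`Δ_{n+1} ⟶ Δ_n` are the functions that are constant on the components of the mutation graph. -/
theorem nonempty_hom_succ_linearEquiv (T : CameronType) (k : Type u) [CommRing k] (n : ℕ+) :
    Nonempty ((T.standardModule k (n + 1) ⟶ T.standardModule k n) ≃ₗ[k]
      (Fin (T.numComponents n (n + 1)) → k)) := by
  have hy : ((T.obj (n + 1)).card : ℕ) = (T.obj n).card + 1 := rfl
  obtain ⟨ε, hε⟩ := exists_sign hy
  let C := (T.mutationGraph n (n + 1)).ConnectedComponent
  have : Finite C := Quot.finite _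
  have hsq : ∀ f, ((ε f : ℤ) : k) * ((ε f : ℤ) : k) = 1 := fun f => by
    rw [← Int.cast_mul, ← Units.val_mul, Int.units_mul_self]
    simp
  let Ψ : (C → k) →ₗ[k] (Emb (T.obj n) (T.obj (n + 1)) → k) :=
    { toFun u f := ((ε f : ℤ) : k) * u (SimpleGraph.connectedComponentMk _ f)
      map_add' u v := by ext f; simp [mul_add]
      map_smul' r u := by ext f; simp [mul_left_comm] }
  have hΨ : Function.Injective Ψ := by
    intro u v huv
    ext C
    induction C using SimpleGraph.ConnectedComponent.ind with | _ f =>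
    have h1 : ((ε f : ℤ) : k) * u (SimpleGraph.connectedComponentMk _ f) =
      ((ε f : ℤ) : k) * v (SimpleGraph.connectedComponentMk _ f) := congrFun huv f
    have h2 := congrArg (fun t => ((ε f : ℤ) : k) * t) h1
    simpa only [← mul_assoc, hsq, one_mul] using h2
  have hrange : LinearMap.range (homCoeff (T := T) (k := k) (n + 1) n) = LinearMap.range Ψ := by
    ext c
    rw [LinearMap.mem_range, exists_homCoeff_eq_iff, fiberSum_eq_zero_iff hy, LinearMap.mem_range]
    constructor
    · intro hc
      have hadj : ∀ f f', (T.mutationGraph n (n + 1)).Adj f f' →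
          ((ε f : ℤ) : k) * c f = ((ε f' : ℤ) : k) * c f' := by
        intro f f' hff'
        rw [hε f f' hff', eq_neg_of_add_eq_zero_right (hc f f' hff')]
        simp
      have hwalk : ∀ {f f'} (_ : (T.mutationGraph n (n + 1)).Walk f f'),
          ((ε f : ℤ) : k) * c f = ((ε f' : ℤ) : k) * c f' := by
        intro f f' p
        induction p with
        | nil => rfl
        | cons h _ ih => exact (hadj _ _ h).trans ih
      refine ⟨SimpleGraph.ConnectedComponent.lift (fun f => ((ε f : ℤ) : k) * c f)
        fun _ _ p _ => hwalk p, ?_⟩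
      ext f
      change ((ε f : ℤ) : k) * (((ε f : ℤ) : k) * c f) = c f
      rw [← mul_assoc, hsq, one_mul]
    · rintro ⟨u, rfl⟩ f f' hff'
      have hadj : (T.mutationGraph n (n + 1)).Adj f f' := hff'
      change ((ε f : ℤ) : k) * u (SimpleGraph.connectedComponentMk _ f) +
        ((ε f' : ℤ) : k) * u (SimpleGraph.connectedComponentMk _ f') = 0
      rw [hε f f' hff', SimpleGraph.ConnectedComponent.sound hadj.reachable]
      simp
  exact ⟨(LinearEquiv.ofInjective _ homCoeff_injective).trans <|
    (LinearEquiv.ofEq _ _ hrange).trans <| (LinearEquiv.ofInjective Ψ hΨ).symm.trans <|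
      LinearEquiv.funCongrLeft k k (Finite.equivFin C).symm⟩

/-- Injective endomorphisms of `[n]` are invertible. -/
theorem exists_aut_inv_eq {n : ℕ+} (f : Emb (T.obj n) (T.obj n)) : ∃ g : T.G n, g.inv = f.1 := by
  let σ : Equiv.Perm (Fin (T.obj n).card) :=
    Equiv.ofBijective _ (Finite.injective_iff_bijective.1 f.2)
  let f' : T.obj n ⟶ T.obj n := ⟨σ.symm, T.isMorphism_symm (σ := σ) f.1.isMorphism⟩
  exact ⟨⟨f', f.1, map_injective (funext σ.apply_symm_apply),
    map_injective (funext σ.symm_apply_apply)⟩, rfl⟩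

theorem injective_map_hom {n : ℕ+} (g : T.G n) : Function.Injective (map g.hom) :=
  Function.LeftInverse.injective (g := map g.inv) fun i =>
    congrFun (congrArg map g.hom_inv_id) i

theorem injective_map_inv {n : ℕ+} (g : T.G n) : Function.Injective (map g.inv) :=
  Function.LeftInverse.injective (g := map g.hom) fun i =>
    congrFun (congrArg map g.inv_hom_id) i

variable (T k) in
/-- The action of `G_n` on `Δ_n` by precomposition; the inverse makes it a left action. -/
noncomputable def precompHom (n : ℕ+) : T.G n →* End (T.standardModule k n) where
  toFun g :=
    { app y := ModuleCat.ofHom <| Submodule.mapQ (nonInjective k (T.obj n) y)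
        (nonInjective k (T.obj n) y) (Finsupp.lmapDomain k k fun f => g.inv ≫ f) <| by
          refine Submodule.span_le.2 ?_
          rintro _ ⟨f, hf, rfl⟩
          refine Submodule.subset_span ⟨g.inv ≫ f, fun h => hf ?_, by simp⟩
          have h' := h.comp (injective_map_hom g)
          have e : g.hom ≫ g.inv ≫ f = f := Iso.hom_inv_id_assoc _ f
          rwa [← map_comp, e] at h'
      naturality y z h := by
        refine ModuleCat.hom_ext (Submodule.linearMap_qext _ (Finsupp.lhom_ext' fun f =>
          LinearMap.ext_ring ?_))
        change Submodule.Quotient.mk (Finsupp.mapDomain (fun f => g.inv ≫ f)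
          (Finsupp.mapDomain (fun f => f ≫ h) (Finsupp.single f 1))) =
          Submodule.Quotient.mk (Finsupp.mapDomain (fun f => f ≫ h)
          (Finsupp.mapDomain (fun f => g.inv ≫ f) (Finsupp.single f 1)))
        simp }
  map_one' := by
    refine NatTrans.ext (funext fun y => ?_)
    refine ModuleCat.hom_ext (Submodule.linearMap_qext _ (Finsupp.lhom_ext' fun f =>
      LinearMap.ext_ring ?_))
    change Submodule.Quotient.mk (Finsupp.mapDomain (fun f => 𝟙 _ ≫ f) (Finsupp.single f 1)) =
      Submodule.Quotient.mk (Finsupp.single f 1)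
    simp
  map_mul' g h := by
    refine NatTrans.ext (funext fun y => ?_)
    refine ModuleCat.hom_ext (Submodule.linearMap_qext _ (Finsupp.lhom_ext' fun f =>
      LinearMap.ext_ring ?_))
    change Submodule.Quotient.mk (Finsupp.mapDomain (fun f => (g.inv ≫ h.inv) ≫ f)
        (Finsupp.single f 1)) =
      Submodule.Quotient.mk (Finsupp.mapDomain (fun f => g.inv ≫ f)
        (Finsupp.mapDomain (fun f => h.inv ≫ f) (Finsupp.single f 1)))
    simp

theorem nonempty_end_algEquiv (T : CameronType) (k : Type u) [CommRing k] (n : ℕ+) :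
    Nonempty (End (T.standardModule k n) ≃ₐ[k] MonoidAlgebra k (T.G n)) := by
  classical
  let Φ := MonoidAlgebra.lift k (End (T.standardModule k n)) (T.G n) (precompHom T k n)
  -- The coefficients of `Φ w` are those of `w`, up to inversion in the group.
  have hΦ : ∀ (w : MonoidAlgebra k (T.G n)) (g : T.G n),
      homCoeff n n (Φ w) ⟨g.inv, injective_map_inv g⟩ = w.coeff g := by
    intro w g
    induction w using MonoidAlgebra.induction_linear with
    | zero => simp
    | add w w' hw hw' =>
      rw [map_add, map_add, Pi.add_apply, hw, hw']
      simp
    | single h r =>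
      have h1 : homCoeff n n (precompHom T k n h) ⟨g.inv, injective_map_inv g⟩ =
          Finsupp.mapDomain (fun f => h.inv ≫ f) (Finsupp.single (𝟙 (T.obj n)) (1 : k)) g.inv := rfl
      have h2 : h.inv = g.inv ↔ h = g := ⟨fun e => Iso.ext_inv e, fun e => e ▸ rfl⟩
      rw [MonoidAlgebra.lift_single, map_smul, Pi.smul_apply, h1, Finsupp.mapDomain_single,
        Category.comp_id, Finsupp.single_apply, MonoidAlgebra.coeff_single, Finsupp.single_apply]
      simp [h2]
  have hinj : Function.Injective Φ := fun w w' h => by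
    ext g
    rw [← hΦ, ← hΦ, h]
  have hsurj : Function.Surjective Φ := by
    intro φ
    have : Finite (T.G n) := Finite.of_injective (fun g => g.hom) fun _ _ e => Iso.ext e
    let w : MonoidAlgebra k (T.G n) := .ofCoeff <| Finsupp.equivFunOnFinite.symm fun g =>
      homCoeff n n φ ⟨g.inv, injective_map_inv g⟩
    refine ⟨w, homCoeff_injective (funext fun f => ?_)⟩
    obtain ⟨g, hg⟩ := exists_aut_inv_eq f
    obtain rfl : (⟨g.inv, injective_map_inv g⟩ : Emb _ _) = f := Subtype.ext hg
    exact hΦ w g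
  exact ⟨(AlgEquiv.ofBijective Φ ⟨hinj, hsurj⟩).symm⟩

end HomSpaces

/-! ### Cyclic order and separation -/

section Relations

variable {n : ℕ}

theorem IsCyclic.rotate {a b c d : Fin n} : IsCyclic a b c d → IsCyclic b c d a := by
  rintro (h | h | h | h)
  exacts [.inr (.inr (.inr h)), .inl h, .inr (.inl h), .inr (.inr (.inl h))]

/-- A map that is increasing off the last point, and takes a least value there, preserves the
cyclic order. -/
theorem isMorphism_CA_of_last {m : ℕ} {f : Fin m → Fin n}
    (h1 : ∀ a b : Fin m, a ≤ b → (b : ℕ) + 1 ≠ m → f a ≤ f b)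
    (h2 : ∀ a b : Fin m, (a : ℕ) + 1 = m → f a ≤ f b) : CA.IsMorphism f := by
  have key : ∀ a b c d, (a ≤ b ∧ b ≤ c ∧ c ≤ d) → IsCyclic (f a) (f b) (f c) (f d) := by
    rintro a b c d ⟨hab, hbc, hcd⟩
    by_cases hd : (d : ℕ) + 1 = m
    · by_cases hc : (c : ℕ) + 1 = m
      · by_cases hb : (b : ℕ) + 1 = m
        · by_cases ha : (a : ℕ) + 1 = m
          · exact .inl ⟨h2 _ _ ha, h2 _ _ hb, h2 _ _ hc⟩
          · exact .inr (.inl ⟨h2 _ _ hb, h2 _ _ hc, h2 _ _ hd⟩)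
        · exact .inr (.inr (.inl ⟨h2 _ _ hc, h2 _ _ hd, h1 _ _ hab hb⟩))
      · exact .inr (.inr (.inr ⟨h2 _ _ hd, h1 _ _ hab (by omega), h1 _ _ hbc hc⟩))
    · exact .inl ⟨h1 _ _ hab (by omega), h1 _ _ hbc (by omega), h1 _ _ hcd hd⟩
  rintro a b c d (h | h | h | h)
  · exact key _ _ _ _ h
  · exact (key _ _ _ _ h).rotate.rotate.rotate
  · exact (key _ _ _ _ h).rotate.rotate
  · exact (key _ _ _ _ h).rotate

theorem isCyclic_ternary_rotate {x y u : Fin n} (h : IsCyclic x y u u) : IsCyclic y u x x := by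
  unfold IsCyclic at *
  omega

theorem isCyclic_rev_of_not {x y u : Fin n} (h : ¬ IsCyclic x y u u) :
    IsCyclic x.rev y.rev u.rev u.rev := by
  unfold IsCyclic at *
  simp only [Fin.rev_le_rev]
  omega

theorem not_isCyclic_rev {x y u : Fin n} (hxy : x < y) (hyu : y < u) :
    ¬ IsCyclic x.rev y.rev u.rev u.rev := by
  unfold IsCyclic
  simp only [Fin.rev_le_rev]
  omega

theorem isCyclic_strictMono_iff {m : ℕ} {e : Fin m → Fin n} (he : StrictMono e) {a b c d : Fin m} :
    IsCyclic (e a) (e b) (e c) (e d) ↔ IsCyclic a b c d := by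
  simp only [IsCyclic, he.le_iff_le]

/-- Points on the two sides of `{x, y}` are separated by it. -/
theorem isSeparated_of_isCyclic_of_not {x y u v : Fin n} (hu : IsCyclic x y u u)
    (hv : ¬ IsCyclic x y v v) : IsSeparated x u y v := by
  unfold IsSeparated IsCyclic at *
  omega

theorem eq_or_eq_of_isSeparated {x y u : Fin n} (h : IsSeparated x u y u) : x = u ∨ y = u := by
  unfold IsSeparated IsCyclic at *
  omega

theorem le_or_eq_of_isSeparated {o x y u : Fin n} (ho : (o : ℕ) = 0)
    (h : IsSeparated o x y u) (hxy : x < y) (hx : o ≠ x) : y ≤ u ∨ u = o := by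
  unfold IsSeparated IsCyclic at *
  omega

end Relations

/-! ### Moves in the mutation graph -/

section Graph

variable {T : CameronType} {n : ℕ+}

theorem adj_of_comp_eq {f f' : Emb (T.obj n) (T.obj (n + 1))}
    (h : Fin ((n : ℕ) + 1) → Fin (n : ℕ)) (hm : T.IsMorphism h) (hs : Function.Surjective h)
    (hcomp : ∀ i, h (map f.1 i) = h (map f'.1 i)) (hne : ∃! i, map f.1 i ≠ map f'.1 i) :
    (T.mutationGraph n (n + 1)).Adj f f' :=
  ⟨hne, T.obj n, ⟨h, hm⟩, rfl, hs, map_injective (funext hcomp)⟩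

/-- The injection of `[n]` into `[n + 1]` obtained from the injective endomorphism `g` by skipping
the point `a`. -/
def skip (a : Fin ((n : ℕ) + 1)) (g : Emb (T.obj n) (T.obj n)) :
    Emb (T.obj n) (T.obj (n + 1)) :=
  ⟨⟨fun i : Fin (n : ℕ) => a.succAbove (map g.1 i),
    (T.isMorphism_comp_strictMono_iff (Fin.strictMono_succAbove a)).2 g.1.isMorphism⟩,
    Fin.succAbove_right_injective.comp g.2⟩

theorem exists_eq_skip (f : Emb (T.obj n) (T.obj (n + 1))) :
    ∃ (a : Fin ((n : ℕ) + 1)) (g : Emb (T.obj n) (T.obj n)), f = skip a g := by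
  obtain ⟨a, ha, -⟩ := exists_missed (x := T.obj n) (y := T.obj (n + 1)) rfl f
  have h : ∀ i : Fin (n : ℕ), ∃ j : Fin (n : ℕ), Fin.succAbove (n := n) a j = map f.1 i :=
    fun i => Fin.exists_succAbove_eq (ha i)
  choose g hg using h
  have hg' : Fin.succAbove (n := n) a ∘ g = map f.1 := funext hg
  have hm : T.IsMorphism g := by
    rw [← T.isMorphism_comp_strictMono_iff (Fin.strictMono_succAbove (n := n) a), hg']
    exact f.1.isMorphism
  have hi : Function.Injective g := by
    have := f.2
    rw [← hg'] at this
    exact this.of_comp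
  exact ⟨a, ⟨⟨g, hm⟩, hi⟩, Subtype.ext (map_injective hg'.symm)⟩

theorem predAbove_succ_succAbove {n : ℕ} (a b : Fin n) :
    a.predAbove (a.succ.succAbove b) = b := by
  rcases lt_or_ge b a with h | h
  · rw [Fin.succAbove_of_castSucc_lt _ _ (Fin.castSucc_lt_succ_iff.2 h.le),
      Fin.predAbove_castSucc_of_le _ _ h.le]
  · rcases h.eq_or_lt with h | h
    · rw [← h, Fin.succAbove_succ_self, Fin.predAbove_castSucc_self]
    · rw [Fin.succAbove_of_le_castSucc _ _ (Nat.succ_le_of_lt h),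
        Fin.predAbove_succ_of_le _ _ h.le]

/-- Collapsing `a` and `a + 1` moves the skipped point. -/
theorem reachable_skip_zero (g : Emb (T.obj n) (T.obj n)) (a : Fin ((n : ℕ) + 1)) :
    (T.mutationGraph n (n + 1)).Reachable (skip a g) (skip 0 g) := by
  induction a using Fin.induction with
  | zero => rfl
  | succ a ih =>
    refine SimpleGraph.Reachable.trans (SimpleGraph.Adj.reachable ?_) ih
    refine adj_of_comp_eq a.predAbove (T.isMorphism_of_monotone a.predAbove_right_monotone)
      a.predAbove_surjective (fun i => ?_) ?_
    · change a.predAbove (a.succ.succAbove (map g.1 i)) =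
        a.predAbove (a.castSucc.succAbove (map g.1 i))
      exact (predAbove_succ_succAbove _ _).trans (Fin.predAbove_succAbove _ _).symm
    · obtain ⟨i₀, hi₀⟩ := (Finite.injective_iff_surjective.1 g.2) a
      have hiff : ∀ b : Fin (n : ℕ), a.succ.succAbove b ≠ a.castSucc.succAbove b ↔ b = a := by
        intro b
        simp only [Fin.succAbove, ne_eq, Fin.ext_iff, Fin.lt_def]
        split_ifs <;> simp_all <;> omega
      refine ⟨i₀, (hiff _).2 hi₀, fun j hj => g.2 (((hiff _).1 hj).trans hi₀.symm)⟩

/-- The increasing injection `[n] ⟶ [n + 1]` that skips the first point. -/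
def base (T : CameronType) (n : ℕ+) : Emb (T.obj n) (T.obj (n + 1)) :=
  skip 0 ⟨𝟙 _, Function.injective_id⟩

theorem reachable_base_of_monotone {g : Emb (T.obj n) (T.obj n)} (hg : Monotone (map g.1))
    (a : Fin ((n : ℕ) + 1)) :
    (T.mutationGraph n (n + 1)).Reachable (skip a g) (base T n) := by
  have h : map g.1 = id := by
    refine (StrictMono.range_inj (hg.strictMono_of_injective g.2) strictMono_id).1 ?_
    rw [(Finite.injective_iff_surjective.1 g.2).range_eq, Set.range_id]
  have : g = ⟨𝟙 _, Function.injective_id⟩ := Subtype.ext (map_injective h)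
  rw [this]
  exact reachable_skip_zero _ a

/-- Collapsing the first and the last point of `[n + 1]` rotates the endomorphism `g`, so that `g`
can be rotated until it fixes the first point. -/
theorem exists_rotation (hT : ∀ {m l : ℕ} {f : Fin m → Fin l}, CA.IsMorphism f → T.IsMorphism f)
    (d : ℕ) : ∀ g : Emb (T.obj n) (T.obj n), (map g.1 ⟨0, n.pos⟩ : ℕ) + d = n →
      ∃ g' : Emb (T.obj n) (T.obj n), (T.mutationGraph n (n + 1)).Reachable (skip 0 g) (skip 0 g') ∧
        (map g'.1 ⟨0, n.pos⟩ : ℕ) = 0 := by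
  induction d with
  | zero =>
    exact fun g hg => absurd (map g.1 ⟨0, n.pos⟩).2 (by rw [add_zero] at hg; exact hg.not_lt)
  | succ d ih =>
    intro g hg
    let r : Fin (n : ℕ) → Fin (n : ℕ) := fun i => ⟨if (i : ℕ) + 1 = n then 0 else i + 1, by grind⟩
    have hr : T.IsMorphism r := hT <| isMorphism_CA_of_last
      (fun a b hab hb => by simp only [r, Fin.mk_le_mk]; grind)
      (fun a b ha => by simp [r, ha])
    let h : Fin ((n : ℕ) + 1) → Fin (n : ℕ) := fun i => ⟨if (i : ℕ) = n then 0 else i, by grind⟩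
    have hh : T.IsMorphism h := hT <| isMorphism_CA_of_last
      (fun a b hab hb => by simp only [h, Fin.mk_le_mk]; grind)
      (fun a b ha => by
        have : (a : ℕ) = n := by omega
        simp [h, this])
    have hrinj : Function.Injective r := by
      intro a b hab
      simp only [r, Fin.mk.injEq] at hab
      grind
    let g' : Emb (T.obj n) (T.obj n) :=
      ⟨⟨r ∘ map g.1, T.isMorphism_comp g.1.isMorphism hr⟩, hrinj.comp g.2⟩
    have hlast : (T.mutationGraph n (n + 1)).Adj (skip 0 g) (skip (Fin.last n) g') := by
      have hiff : ∀ b : Fin (n : ℕ), Fin.succAbove 0 b ≠ (Fin.last (n : ℕ)).succAbove (r b) ↔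
          (b : ℕ) + 1 = n := by
        intro b
        rw [Fin.succAbove_zero, Fin.succAbove_last, Ne, Fin.ext_iff]
        simp only [r, Fin.val_succ, Fin.val_castSucc]
        grind
      refine adj_of_comp_eq h hh (fun p => ⟨p.castSucc, ?_⟩) (fun i => ?_) ?_
      · have := p.2
        ext
        simp only [h, Fin.val_castSucc]
        grind
      · change h (Fin.succAbove 0 (map g.1 i)) = h ((Fin.last (n : ℕ)).succAbove (r (map g.1 i)))
        have := (map g.1 i).2
        rw [Fin.succAbove_zero, Fin.succAbove_last]
        ext
        simp only [h, r, Fin.val_succ, Fin.val_castSucc]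
        grind
      · obtain ⟨i₀, hi₀⟩ := (Finite.injective_iff_surjective.1 g.2)
          (⟨n - 1, Nat.sub_lt n.pos one_pos⟩ : Fin (n : ℕ))
        have hv : ∀ i, ((map g.1 i : Fin (n : ℕ)) : ℕ) + 1 = n ↔ i = i₀ := by
          intro i
          rw [← g.2.eq_iff, hi₀]
          have := n.pos
          refine Iff.trans ?_ Fin.ext_iff.symm
          change _ ↔ ((map g.1 i : Fin (n : ℕ)) : ℕ) = n - 1
          omega
        exact ⟨i₀, (hiff _).2 ((hv _).2 rfl), fun j hj => (hv _).1 ((hiff _).1 hj)⟩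
    have hstep := hlast.reachable.trans (reachable_skip_zero g' _)
    have hval : (map g'.1 ⟨0, n.pos⟩ : ℕ) = if (map g.1 ⟨0, n.pos⟩ : ℕ) + 1 = n then 0 else
      (map g.1 ⟨0, n.pos⟩ : ℕ) + 1 := rfl
    by_cases hd : d = 0
    · refine ⟨g', hstep, ?_⟩
      rw [hval, if_pos (by omega)]
    · rw [if_neg (by omega)] at hval
      obtain ⟨g'', h1, h2⟩ := ih g' (by omega)
      exact ⟨g'', hstep.trans h1, h2⟩

end Graph

/-! ### Orientations and the number of components -/

section Counting

variable {T : CameronType} {n : ℕ+}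

/-- Between sets, the maps that differ at exactly one point are always mutations of each other:
collapse the two values by a retraction onto the first map. -/
theorem adj_FA_of_update {f f' : Emb (FA.obj n) (FA.obj (n + 1))} {i₀ a}
    (ha : ∀ i, map f.1 i ≠ a) (hf' : map f'.1 = Function.update (map f.1) i₀ a) :
    (FA.mutationGraph n (n + 1)).Adj f f' := by
  classical
  have : Nonempty (Fin (FA.obj n).card) := ⟨i₀⟩
  let h : Fin (FA.obj (n + 1)).card → Fin (FA.obj n).card := fun p =>
    if p = a then i₀ else Function.invFun (map f.1) p
  have hf : ∀ i, h (map f.1 i) = i := fun i => by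
    simp only [h, if_neg (ha i), Function.leftInverse_invFun f.2 i]
  refine adj_of_comp_eq h trivial (fun i => ⟨_, hf i⟩) (fun i => ?_)
    (existsUnique_ne_of_update ha hf')
  rw [hf, hf']
  rcases eq_or_ne i i₀ with rfl | hi
  · rw [Function.update_self]
    exact (if_pos rfl).symm
  · rw [Function.update_of_ne hi, hf]

theorem exists_adj_FA (f : Emb (FA.obj n) (FA.obj (n + 1))) (i₀ : Fin (FA.obj n).card)
    (a : Fin (FA.obj (n + 1)).card) (ha : ∀ i, map f.1 i ≠ a) :
    ∃ f' : Emb (FA.obj n) (FA.obj (n + 1)), (FA.mutationGraph n (n + 1)).Adj f f' ∧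
      map f'.1 = Function.update (map f.1) i₀ a := by
  classical
  have hinj : Function.Injective (Function.update (map f.1) i₀ a) := by
    intro i j hij
    by_cases hi : i = i₀ <;> by_cases hj : j = i₀
    · rw [hi, hj]
    · rw [hi, Function.update_self, Function.update_of_ne hj] at hij
      exact absurd hij.symm (ha j)
    · rw [hj, Function.update_self, Function.update_of_ne hi] at hij
      exact absurd hij (ha i)
    · rw [Function.update_of_ne hj, Function.update_of_ne hi] at hij
      exact f.2 hij
  exact ⟨⟨⟨_, trivial⟩, hinj⟩, adj_FA_of_update ha rfl, rfl⟩

/-- Any injection `f` of sets is turned into a given one `s` by mutations, by induction on the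
number of points where they disagree: if the point missed by `f` is `s i`, the value of `f` at `i`
can be corrected, and otherwise moving a wrong value frees a point of the image of `s`. -/
theorem reachable_FA (s : Emb (FA.obj n) (FA.obj (n + 1))) (d : ℕ) :
    ∀ f : Emb (FA.obj n) (FA.obj (n + 1)),
      (Finset.univ.filter fun i => map f.1 i ≠ map s.1 i).card = d →
        (FA.mutationGraph n (n + 1)).Reachable f s := by
  classical
  induction d using Nat.strong_induction_on with
  | _ d ih =>
  intro f hd
  have hgood : ∀ f : Emb (FA.obj n) (FA.obj (n + 1)),
      (Finset.univ.filter fun i => map f.1 i ≠ map s.1 i).card ≤ d →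
      (∃ i, ∀ j, map f.1 j ≠ map s.1 i) → (FA.mutationGraph n (n + 1)).Reachable f s := by
    rintro f hf ⟨i, hi⟩
    obtain ⟨f', hadj, hf'⟩ := exists_adj_FA f i _ hi
    refine hadj.reachable.trans (ih _ (lt_of_lt_of_le (Finset.card_lt_card ?_) hf) f' rfl)
    rw [Finset.ssubset_iff_of_subset]
    · exact ⟨i, by simpa using hi i, by simp [hf']⟩
    · intro j
      rcases eq_or_ne j i with rfl | hj
      · simp [hf']
      · simp [hf', hj]
  by_cases hex : ∃ i, ∀ j, map f.1 j ≠ map s.1 i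
  · exact hgood f hd.le hex
  push Not at hex
  by_cases heq : ∃ i, map f.1 i ≠ map s.1 i
  swap
  · push Not at heq
    rw [show f = s from Subtype.ext (map_injective (funext heq))]
  obtain ⟨i, hi⟩ := heq
  obtain ⟨a, ha, hr⟩ := exists_missed (x := FA.obj n) (y := FA.obj (n + 1)) rfl f
  have hsa : ∀ j, map s.1 j ≠ a := by
    intro j hj
    obtain ⟨l, hl⟩ := hex j
    exact ha l (hl.trans hj)
  obtain ⟨f', hadj, hf'⟩ := exists_adj_FA f i a ha
  refine hadj.reachable.trans (hgood f' (hd ▸ Finset.card_le_card fun j => ?_) ?_)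
  · rcases eq_or_ne j i with rfl | hj
    · simp [hi]
    · simp [hf', hj]
  · -- The freed point `f i` lies in the image of `s`, which like that of `f` misses only `a`.
    obtain ⟨b, hb, hr'⟩ := exists_missed (x := FA.obj n) (y := FA.obj (n + 1)) rfl s
    obtain rfl : a = b := (hr' a).resolve_right fun ⟨j, hj⟩ => hsa j hj
    obtain ⟨j, hj⟩ := (hr' (map f.1 i)).resolve_left (ha i)
    refine ⟨j, fun l => ?_⟩
    rw [hj, hf']
    rcases eq_or_ne l i with rfl | hl
    · rw [Function.update_self]
      exact (ha l).symm
    · rw [Function.update_of_ne hl]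
      exact fun e => hl (f.2 e)

theorem reachable_base_OA (f : Emb (OA.obj n) (OA.obj (n + 1))) :
    (OA.mutationGraph n (n + 1)).Reachable f (base OA n) := by
  obtain ⟨a, g, rfl⟩ := exists_eq_skip f
  exact reachable_base_of_monotone (fun i j hij => g.1.isMorphism i j hij) a

/-- After rotation the endomorphism fixes the first point, and is then increasing. -/
theorem reachable_base_CA (f : Emb (CA.obj n) (CA.obj (n + 1))) :
    (CA.mutationGraph n (n + 1)).Reachable f (base CA n) := by
  obtain ⟨a, g, rfl⟩ := exists_eq_skip f
  obtain ⟨g', hg, h0⟩ := exists_rotation (T := CA) (fun h => h) (n - map g.1 ⟨0, n.pos⟩) g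
    (Nat.add_sub_cancel' (map g.1 ⟨0, n.pos⟩).2.le)
  refine (reachable_skip_zero g a).trans (hg.trans (reachable_base_of_monotone ?_ 0))
  intro i j hij
  have h1 := g'.1.isMorphism ⟨0, n.pos⟩ ⟨0, n.pos⟩ i j (.inl ⟨le_rfl, Nat.zero_le _, hij⟩)
  change IsCyclic (map g'.1 ⟨0, n.pos⟩) (map g'.1 ⟨0, n.pos⟩) (map g'.1 i) (map g'.1 j) at h1
  have h2 : map g'.1 j = map g'.1 ⟨0, n.pos⟩ → map g'.1 i = map g'.1 ⟨0, n.pos⟩ := by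
    intro h
    obtain rfl := g'.2 h
    obtain rfl : i = ⟨0, n.pos⟩ := Fin.ext (Nat.le_zero.1 hij)
    rfl
  unfold IsCyclic at h1
  omega

/-- The injections that respect the order of the first two points. -/
def IsPositiveBA (f : Emb (BA.obj n) (BA.obj (n + 1))) : Prop :=
  ∀ h : 1 < (n : ℕ), map f.1 ⟨0, n.pos⟩ < map f.1 ⟨1, h⟩

theorem reachable_base_BA {f : Emb (BA.obj n) (BA.obj (n + 1))} (hf : IsPositiveBA f) :
    (BA.mutationGraph n (n + 1)).Reachable f (base BA n) := by
  obtain ⟨a, g, rfl⟩ := exists_eq_skip f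
  refine reachable_base_of_monotone ?_ a
  have hb : ∀ b c d, IsBetween b c d → IsBetween (map g.1 b) (map g.1 c) (map g.1 d) :=
    g.1.isMorphism
  have h0 : ∀ j : Fin (BA.obj n).card, (0 : ℕ) < j → map g.1 ⟨0, n.pos⟩ < map g.1 j := by
    intro j hj
    have hn : 1 < (n : ℕ) := lt_of_le_of_lt hj j.2
    have h01 : map g.1 ⟨0, n.pos⟩ < map g.1 ⟨1, hn⟩ :=
      (Fin.strictMono_succAbove (n := n) a).lt_iff_lt.1 (hf hn)
    have h1 := hb ⟨0, n.pos⟩ ⟨1, hn⟩ j (.inl ⟨Nat.zero_le _, hj⟩)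
    unfold IsBetween at h1
    omega
  intro i j hij
  rcases Nat.eq_zero_or_pos i with hi | hi
  · obtain rfl : i = ⟨0, n.pos⟩ := Fin.ext hi
    rcases Nat.eq_zero_or_pos j with hj | hj
    · exact le_of_eq (congrArg _ (Fin.ext hj.symm))
    · exact (h0 j hj).le
  · have h1 := hb ⟨0, n.pos⟩ i j (.inl ⟨Nat.zero_le _, hij⟩)
    have h2 := h0 i hi
    unfold IsBetween at h1
    omega

/-- The injections that respect the cyclic order of the first three points. -/
def IsPositiveSA (f : Emb (SA.obj n) (SA.obj (n + 1))) : Prop :=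
  ∀ h : 2 < (n : ℕ), IsCyclic (map f.1 ⟨0, n.pos⟩) (map f.1 ⟨1, Nat.lt_of_succ_lt h⟩)
    (map f.1 ⟨2, h⟩) (map f.1 ⟨2, h⟩)

/-- Neighbours in the mutation graph agree off one point `i₀`, and the collapsing morphism `h` takes
them to the same map, which is injective. -/
theorem exists_morphism_of_adj {f f' : Emb (T.obj n) (T.obj (n + 1))}
    (hff' : (T.mutationGraph n (n + 1)).Adj f f') :
    ∃ (i₀ : Fin (T.obj n).card) (z : T.Obj) (h : T.obj (n + 1) ⟶ z),
      (∀ i, i ≠ i₀ → map f'.1 i = map f.1 i) ∧ (∀ i, map h (map f'.1 i) = map h (map f.1 i)) ∧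
      ∀ i j, map h (map f.1 i) = map h (map f.1 j) → i = j := by
  classical
  obtain ⟨i₀, a, ha, hf'⟩ := IsMutation.exists_update hff'
  obtain ⟨-, z, h, hz, hs, hcomp⟩ := hff'
  have hc : ∀ i, map h (map f'.1 i) = map h (map f.1 i) :=
    fun i => (congrFun (congrArg map hcomp) i).symm
  have hia : map h a = map h (map f.1 i₀) := by
    rw [← hc, hf', Function.update_self]
  have hinj := injective_comp_of_collapse (x := T.obj n) (y := T.obj (n + 1)) rfl f h hz hs ha hia
  exact ⟨i₀, z, h, fun i hi => by rw [hf', Function.update_of_ne hi], hc, fun i j hij => hinj hij⟩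

theorem IsPositiveBA.of_adj {f f' : Emb (BA.obj n) (BA.obj (n + 1))} (hf : IsPositiveBA f)
    (hff' : (BA.mutationGraph n (n + 1)).Adj f f') : IsPositiveBA f' := by
  intro hn
  have h01 := hf hn
  obtain ⟨i₀, z, h, hne, hcomp, hinj⟩ := exists_morphism_of_adj hff'
  have hb : ∀ b c d, IsBetween b c d → IsBetween (map h b) (map h c) (map h d) := h.isMorphism
  have hne01 : (⟨0, n.pos⟩ : Fin (BA.obj n).card) ≠ ⟨1, hn⟩ :=
    Fin.ne_of_val_ne (by decide : (0 : ℕ) ≠ 1)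
  have hh : map h (map f.1 ⟨0, n.pos⟩) ≠ map h (map f.1 ⟨1, hn⟩) := fun e => hne01 (hinj _ _ e)
  have hlt : map f'.1 ⟨0, n.pos⟩ ≠ map f'.1 ⟨1, hn⟩ := fun e => hne01 (f'.2 e)
  -- If the order of the two values changed, `h` would identify all three values involved.
  by_contra hcon
  rcases eq_or_ne i₀ ⟨0, n.pos⟩ with rfl | h0
  · have h1 := hne _ hne01.symm
    have h2 := hb (map f.1 ⟨0, n.pos⟩) (map f.1 ⟨1, hn⟩) (map f'.1 ⟨0, n.pos⟩)
      (.inl ⟨h01.le, by omega⟩)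
    rw [hcomp] at h2
    unfold IsBetween at h2
    omega
  · have h1 := hne _ h0.symm
    have h2 := hb (map f.1 ⟨1, hn⟩) (map f.1 ⟨0, n.pos⟩) (map f'.1 ⟨1, hn⟩)
      (.inr ⟨by omega, h01.le⟩)
    rw [hcomp] at h2
    unfold IsBetween at h2
    omega

theorem IsPositiveSA.of_adj {f f' : Emb (SA.obj n) (SA.obj (n + 1))} (hf : IsPositiveSA f)
    (hff' : (SA.mutationGraph n (n + 1)).Adj f f') : IsPositiveSA f' := by
  intro hn
  have hpos := hf hn
  obtain ⟨i₀, z, h, hne, hcomp, hinj⟩ := exists_morphism_of_adj hff'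
  have hs : ∀ a b c d, IsSeparated a b c d →
    IsSeparated (map h a) (map h b) (map h c) (map h d) := h.isMorphism
  -- If moving one of three cyclically ordered points `i`, `j`, `l` changed their orientation, its
  -- old and new values would be separated by the other two, but `h` identifies them.
  have key : ∀ i j l, i ≠ l → j ≠ l → i₀ ≠ i → i₀ ≠ j →
      IsCyclic (map f.1 i) (map f.1 j) (map f.1 l) (map f.1 l) →
      IsCyclic (map f'.1 i) (map f'.1 j) (map f'.1 l) (map f'.1 l) := by
    intro i j l hil hjl hi hj hc
    rw [hne i hi.symm, hne j hj.symm]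
    by_contra hcon
    have h1 := hs _ _ _ _ (isSeparated_of_isCyclic_of_not hc hcon)
    rw [hcomp] at h1
    rcases eq_or_eq_of_isSeparated h1 with e | e
    exacts [hil (hinj _ _ e), hjl (hinj _ _ e)]
  have h01 : (⟨0, n.pos⟩ : Fin (SA.obj n).card) ≠ ⟨1, Nat.lt_of_succ_lt hn⟩ :=
    Fin.ne_of_val_ne (by decide : (0 : ℕ) ≠ 1)
  have h02 : (⟨0, n.pos⟩ : Fin (SA.obj n).card) ≠ ⟨2, hn⟩ :=
    Fin.ne_of_val_ne (by decide : (0 : ℕ) ≠ 2)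
  have h12 : (⟨1, Nat.lt_of_succ_lt hn⟩ : Fin (SA.obj n).card) ≠ ⟨2, hn⟩ :=
    Fin.ne_of_val_ne (by decide : (1 : ℕ) ≠ 2)
  by_cases h0 : i₀ = ⟨0, n.pos⟩
  · subst h0
    exact isCyclic_ternary_rotate (isCyclic_ternary_rotate
      (key _ _ _ h01.symm h02.symm h01 h02 (isCyclic_ternary_rotate hpos)))
  by_cases h1 : i₀ = ⟨1, Nat.lt_of_succ_lt hn⟩
  · rw [h1] at key
    exact isCyclic_ternary_rotate (key _ _ _ h12.symm h01 h12 h01.symm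
      (isCyclic_ternary_rotate (isCyclic_ternary_rotate hpos)))
  exact key _ _ _ h02 h12 h0 h1 hpos

theorem IsPositiveSA.of_reachable {f f' : Emb (SA.obj n) (SA.obj (n + 1))} (hf : IsPositiveSA f)
    (hff' : (SA.mutationGraph n (n + 1)).Reachable f f') : IsPositiveSA f' := by
  obtain ⟨p⟩ := hff'
  induction p with
  | nil => exact hf
  | cons h _ ih => exact ih (hf.of_adj h)

theorem reachable_base_SA {f : Emb (SA.obj n) (SA.obj (n + 1))} (hf : IsPositiveSA f) :
    (SA.mutationGraph n (n + 1)).Reachable f (base SA n) := by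
  obtain ⟨a, g, rfl⟩ := exists_eq_skip f
  obtain ⟨g', hg, h0⟩ := exists_rotation (T := SA) isMorphism_SA_of_CA
    (n - map g.1 ⟨0, n.pos⟩) g (Nat.add_sub_cancel' (map g.1 ⟨0, n.pos⟩).2.le)
  have hr := (reachable_skip_zero g a).trans hg
  refine hr.trans (reachable_base_of_monotone ?_ 0)
  have hpos := hf.of_reachable hr
  have hs : ∀ a b c d, IsSeparated a b c d →
    IsSeparated (map g'.1 a) (map g'.1 b) (map g'.1 c) (map g'.1 d) := g'.1.isMorphism
  have hz : ∀ j : Fin (SA.obj n).card, (0 : ℕ) < j → map g'.1 ⟨0, n.pos⟩ ≠ map g'.1 j := by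
    intro j hj e
    rw [← g'.2 e] at hj
    exact absurd hj (lt_irrefl 0)
  have h1 : ∀ (hn : 1 < (n : ℕ)) (j : Fin (SA.obj n).card), (1 : ℕ) < j →
      map g'.1 ⟨1, hn⟩ < map g'.1 j := by
    intro hn j hj
    have hn2 : 2 < (n : ℕ) := lt_of_le_of_lt hj j.2
    have h12 : map g'.1 ⟨1, hn⟩ < map g'.1 ⟨2, hn2⟩ := by
      have hc : IsCyclic (map g'.1 ⟨0, n.pos⟩) (map g'.1 ⟨1, hn⟩) (map g'.1 ⟨2, hn2⟩)
          (map g'.1 ⟨2, hn2⟩) :=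
        (isCyclic_strictMono_iff (Fin.strictMono_succAbove (n := n) 0)).1 (hpos hn2)
      have hz1 := hz ⟨1, hn⟩ one_pos
      have hz2 := hz ⟨2, hn2⟩ two_pos
      have h3 : map g'.1 ⟨1, hn⟩ ≠ map g'.1 ⟨2, hn2⟩ := fun e =>
        absurd (Fin.val_eq_of_eq (g'.2 e)) (by decide : (1 : ℕ) ≠ 2)
      unfold IsCyclic at hc
      omega
    have hsep := hs ⟨0, n.pos⟩ ⟨1, hn⟩ ⟨2, hn2⟩ j
      (.inl (.inl ⟨Nat.zero_le _, Nat.le_succ 1, hj⟩))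
    exact h12.trans_le ((le_or_eq_of_isSeparated h0 hsep h12 (hz _ one_pos)).resolve_right
      (hz j (by omega)).symm)
  intro i j hij
  rcases Nat.eq_zero_or_pos i with hi | hi
  · obtain rfl : i = ⟨0, n.pos⟩ := Fin.ext hi
    exact Fin.le_def.2 (h0.trans_le (Nat.zero_le _))
  have hn : 1 < (n : ℕ) := lt_of_le_of_lt hi i.2
  rcases (Nat.succ_le_of_lt hi).eq_or_lt with hi1 | hi1
  · obtain rfl : i = ⟨1, hn⟩ := Fin.ext hi1.symm
    rcases (show (1 : ℕ) ≤ j from hij).eq_or_lt with hj | hj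
    · exact le_of_eq (congrArg _ (Fin.ext hj))
    · exact (h1 hn j hj).le
  · have hsep := hs ⟨0, n.pos⟩ ⟨1, hn⟩ i j (.inl (.inl ⟨Nat.zero_le _, hi, hij⟩))
    exact (le_or_eq_of_isSeparated h0 hsep (h1 hn i hi1) (hz _ one_pos)).resolve_right
      (hz j (hi.trans_le hij)).symm

/-- Reversal of `[n + 1]`, acting on injections by postcomposition. -/
def reflect (hrev : T.IsMorphism (Fin.rev : Fin ((n : ℕ) + 1) → _))
    (f : Emb (T.obj n) (T.obj (n + 1))) : Emb (T.obj n) (T.obj (n + 1)) :=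
  ⟨⟨Fin.rev ∘ map f.1, T.isMorphism_comp f.1.isMorphism hrev⟩, Fin.rev_injective.comp f.2⟩

variable (hrev : T.IsMorphism (Fin.rev : Fin ((n : ℕ) + 1) → _))

theorem reflect_reflect (f : Emb (T.obj n) (T.obj (n + 1))) :
    reflect hrev (reflect hrev f) = f :=
  Subtype.ext (map_injective (funext fun _ => Fin.rev_rev _))

theorem reflect_adj {f f' : Emb (T.obj n) (T.obj (n + 1))}
    (h : (T.mutationGraph n (n + 1)).Adj f f') :
    (T.mutationGraph n (n + 1)).Adj (reflect hrev f) (reflect hrev f') := by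
  obtain ⟨⟨i, hi, hu⟩, z, h, hz, hs, hcomp⟩ := h
  refine ⟨⟨i, fun e => hi (Fin.rev_injective e), fun j hj => hu j fun e => hj (congrArg Fin.rev e)⟩,
    z, ⟨map h ∘ Fin.rev, T.isMorphism_comp hrev h.isMorphism⟩, hz, hs.comp Fin.rev_surjective,
    map_injective (funext fun j => ?_)⟩
  change map h (Fin.rev (Fin.rev (map f.1 j))) = map h (Fin.rev (Fin.rev (map f'.1 j)))
  rw [Fin.rev_rev, Fin.rev_rev]
  exact congrFun (congrArg map hcomp) j

theorem numComponents_eq_one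
    (h : ∀ f, (T.mutationGraph n (n + 1)).Reachable f (base T n)) :
    T.numComponents n (n + 1) = 1 := by
  have : Nonempty (Emb (T.obj n) (T.obj (n + 1))) := ⟨base T n⟩
  have : (T.mutationGraph n (n + 1)).Connected := ⟨fun f f' => (h f).trans (h f').symm⟩
  have := this.preconnected.subsingleton_connectedComponent
  have : Nonempty (T.mutationGraph n (n + 1)).ConnectedComponent :=
    ⟨SimpleGraph.connectedComponentMk _ (base T n)⟩
  exact Nat.card_unique

/-- Two components result when an orientation `P` is preserved by mutations and reversed by the
reflection, and the positive injections are connected to each other. -/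
theorem numComponents_eq_two (P : Emb (T.obj n) (T.obj (n + 1)) → Prop)
    (hadj : ∀ f f', (T.mutationGraph n (n + 1)).Adj f f' → P f → P f')
    (hreach : ∀ f, P f → (T.mutationGraph n (n + 1)).Reachable f (base T n))
    (hbase : P (base T n)) (hbase' : ¬ P (reflect hrev (base T n)))
    (hneg : ∀ f, ¬ P f → P (reflect hrev f)) :
    T.numComponents n (n + 1) = 2 := by
  refine Nat.card_eq_two_iff.2 ⟨SimpleGraph.connectedComponentMk _ (base T n),
    SimpleGraph.connectedComponentMk _ (reflect hrev (base T n)), fun e => hbase' ?_, ?_⟩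
  · have hwalk : ∀ {f f'} (_ : (T.mutationGraph n (n + 1)).Walk f f'), P f → P f' := by
      intro f f' p
      induction p with
      | nil => exact id
      | cons h _ ih => exact fun hp => ih (hadj _ _ h hp)
    obtain ⟨p⟩ := SimpleGraph.ConnectedComponent.exact e
    exact hwalk p hbase
  · refine Set.eq_univ_of_forall fun C => ?_
    induction C using SimpleGraph.ConnectedComponent.ind with | _ f =>
    by_cases hf : P f
    · exact .inl (SimpleGraph.ConnectedComponent.sound (hreach f hf))
    · have h1 := hreach _ (hneg f hf)
      let R : T.mutationGraph n (n + 1) →g T.mutationGraph n (n + 1) :=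
        ⟨reflect hrev, reflect_adj hrev⟩
      have h2 : (T.mutationGraph n (n + 1)).Reachable (reflect hrev (reflect hrev f))
        (reflect hrev (base T n)) := h1.map R
      rw [reflect_reflect] at h2
      exact .inr (SimpleGraph.ConnectedComponent.sound h2)

theorem map_base_lt {i j : Fin (n : ℕ)} (h : i < j) :
    map (base T n).1 i < map (base T n).1 j :=
  Fin.strictMono_succAbove (n := n) 0 h

theorem numComponents_BA :
    BA.numComponents n (n + 1) = if 2 ≤ n then 2 else 1 := by
  split_ifs with hn
  · have hn' : 1 < (n : ℕ) := hn
    have h01 : map (base BA n).1 ⟨0, n.pos⟩ < map (base BA n).1 ⟨1, hn'⟩ :=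
      map_base_lt (Fin.mk_lt_mk.2 one_pos)
    refine numComponents_eq_two (isMorphism_BA_of_antitone Fin.rev_anti) IsPositiveBA
      (fun f f' h hf => hf.of_adj h) (fun f => reachable_base_BA) (fun _ => h01)
      (fun h => ?_) (fun f hf h => ?_)
    · exact lt_asymm (h hn') (Fin.rev_lt_rev.2 h01)
    · have h1 : ¬ map f.1 ⟨0, n.pos⟩ < map f.1 ⟨1, hn'⟩ := fun e => hf fun _ => e
      refine Fin.rev_lt_rev.2 (lt_of_le_of_ne (not_lt.1 h1) fun e => ?_)
      exact absurd (Fin.val_eq_of_eq (f.2 e)) (by decide : (1 : ℕ) ≠ 0)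
  · have hn' : ¬ 1 < (n : ℕ) := hn
    exact numComponents_eq_one fun f => reachable_base_BA fun h => absurd h hn'

theorem numComponents_SA :
    SA.numComponents n (n + 1) = if 3 ≤ n then 2 else 1 := by
  split_ifs with hn
  · have hn' : 2 < (n : ℕ) := hn
    have h01 : map (base SA n).1 ⟨0, n.pos⟩ < map (base SA n).1 ⟨1, Nat.lt_of_succ_lt hn'⟩ :=
      map_base_lt (Fin.mk_lt_mk.2 one_pos)
    have h12 : map (base SA n).1 ⟨1, Nat.lt_of_succ_lt hn'⟩ < map (base SA n).1 ⟨2, hn'⟩ :=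
      map_base_lt (Fin.mk_lt_mk.2 (Nat.lt_succ_self 1))
    refine numComponents_eq_two (isMorphism_SA_of_antitone Fin.rev_anti) IsPositiveSA
      (fun f f' h hf => hf.of_adj h) (fun f => reachable_base_SA)
      (fun _ => .inl ⟨h01.le, h12.le, le_rfl⟩) (fun h => ?_) (fun f hf _ => ?_)
    · exact not_isCyclic_rev h01 h12 (h hn')
    · exact isCyclic_rev_of_not fun e => hf fun _ => e
  · have hn' : ¬ 2 < (n : ℕ) := hn
    exact numComponents_eq_one fun f => reachable_base_SA fun h => absurd h hn'

end Counting

end CameronType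

theorem mainTheorem3 :
    (∀ (T : CameronType) (k : Type u) [CommRing k],
      (∀ n : ℕ+, Nonempty (End (T.standardModule k n) ≃ₐ[k] MonoidAlgebra k (T.G n))) ∧
      (∀ n : ℕ+, Nonempty ((T.standardModule k (n + 1) ⟶ T.standardModule k n) ≃ₗ[k]
        (Fin (T.numComponents n (n + 1)) → k))) ∧
      (∀ m n : ℕ+, m ≠ n → m ≠ n + 1 →
        ∀ φ : T.standardModule k m ⟶ T.standardModule k n, φ = 0)) ∧
    (∀ n : ℕ+,
      CameronType.FA.numComponents n (n + 1) = 1 ∧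
      CameronType.OA.numComponents n (n + 1) = 1 ∧
      CameronType.CA.numComponents n (n + 1) = 1 ∧
      CameronType.BA.numComponents n (n + 1) = (if 2 ≤ n then 2 else 1) ∧
      CameronType.SA.numComponents n (n + 1) = (if 3 ≤ n then 2 else 1)) :=
  ⟨fun T k _ => ⟨T.nonempty_end_algEquiv k, T.nonempty_hom_succ_linearEquiv k,
    fun _ _ h h' φ => CameronType.hom_eq_zero h h' φ⟩,
  fun _ => ⟨CameronType.numComponents_eq_one fun f => CameronType.reachable_FA _ _ f rfl,
    CameronType.numComponents_eq_one CameronType.reachable_base_OA,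
    CameronType.numComponents_eq_one CameronType.reachable_base_CA,
    CameronType.numComponents_BA, CameronType.numComponents_SA⟩⟩
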